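/- Let $\alpha$ be a real constant with $0<\alpha\le 1$. Then there is $n_0=n_0(\alpha)$ such that the following holds for every $n\ge n_0$. For a finite simple graph $G$ and a set $A\subseteq V(G)$ let $N(A)$ be the set of all vertices outside $A$ that have at least one neighbour in $A$. For real numbers $s,g,l$, the graph $G$ has property $S(s,g)$ if $|N(A)|\ge s|A|$ for every $A\subseteq V(G)$ with $|A|\le g$, and it has property $L(l)$ if there is an edge of $G$ between any two disjoint sets $A,B\subseteq V(G)$ with $|A|,|B|\ge l$. A graph on $n$ vertices is called an $s$-expander if it has the properties $S\left(s,\frac{4n\ln s}{s\ln n}\right)$ and $L\left(\frac{n\ln s}{3000\ln n}\right)$. A Hamilton packing (respectively, Hamilton covering) of $G$ is a family of Hamilton cycles of $G$ such that every edge of $G$ is contained in at most (respectively, at least) one member of the family; its size is the number of its members. Let $\Delta(G)$ denote the maximum degree of $G$. Every $n^{\alpha}$-expander $G$ on $n$ vertices that has a Hamilton packing of size $h$ has a Hamilton covering of size at most $$h+\frac{28000\,(\Delta(G)-2h)}{\alpha^4}.$$ -/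

import Mathlib

namespace HamiltonCovering

open Classical in
/-- The (external) neighborhood `N(A)` of a set `A` of vertices: all the vertices outside `A`
having at least one neighbor in `A`. -/
noncomputable def extNeighbors {V : Type*} [Fintype V] (G : SimpleGraph V) (A : Finset V) : Finset V :=
  Finset.univ.filter fun v => v ∉ A ∧ ∃ a ∈ A, G.Adj a v

/-- The small expander property `S(s, g)` with expansion factor `s` and boundary `g`. -/
def SmallExpander {V : Type*} [Fintype V] (G : SimpleGraph V) (s g : ℝ) : Prop :=
  ∀ A : Finset V, (A.card : ℝ) ≤ g → (A.card : ℝ) * s ≤ ((extNeighbors G A).card : ℝ)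

/-- The large expander property `L(l)` with frame `l`: there is an edge between any two
disjoint vertex sets of size at least `l`. -/
def LargeExpander {V : Type*} [Fintype V] (G : SimpleGraph V) (l : ℝ) : Prop :=
  ∀ A B : Finset V, Disjoint A B → l ≤ (A.card : ℝ) → l ≤ (B.card : ℝ) →
    ∃ a ∈ A, ∃ b ∈ B, G.Adj a b

/-- A graph is an `(s, g, l)`-expander if it has the properties `S(s, g)` and `L(l)`. -/
def IsExpanderWith {V : Type*} [Fintype V] (G : SimpleGraph V) (s g l : ℝ) : Prop :=
  SmallExpander G s g ∧ LargeExpander G l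

/-- An `s`-expander on `n` vertices is an
`(s, 4 n ln s / (s ln n), n ln s / (3000 ln n))`-expander. -/
def IsExpander {V : Type*} [Fintype V] (G : SimpleGraph V) (s : ℝ) : Prop :=
  IsExpanderWith G s
    (4 * (Fintype.card V : ℝ) * Real.log s / (s * Real.log (Fintype.card V : ℝ)))
    ((Fintype.card V : ℝ) * Real.log s / (3000 * Real.log (Fintype.card V : ℝ)))

/-- A subgraph of `G` is a Hamilton cycle of `G` if it consists of the vertices and edges of a
closed walk which is a cycle through all the vertices. Two closed walks that differ only in
their starting point or direction give the same Hamilton cycle. -/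
def IsHamiltonCycle {V : Type*} [DecidableEq V] (G : SimpleGraph V) (C : G.Subgraph) : Prop :=
  ∃ (v : V) (p : G.Walk v v), p.IsHamiltonianCycle ∧ p.toSubgraph = C

/-- A Hamilton packing of `G`: a family of Hamilton cycles of `G` such that every edge of `G`
is contained in at most one of them. Its size is its cardinality. -/
def IsHamiltonPacking {V : Type*} [DecidableEq V] (G : SimpleGraph V)
    (F : Finset G.Subgraph) : Prop :=
  (∀ C ∈ F, IsHamiltonCycle G C) ∧
    ∀ e ∈ G.edgeSet, ∀ C ∈ F, ∀ D ∈ F, e ∈ C.edgeSet → e ∈ D.edgeSet → C = D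

/-- A Hamilton covering of `G`: a family of Hamilton cycles of `G` such that every edge of `G`
is contained in at least one of them. Its size is its cardinality. -/
def IsHamiltonCovering {V : Type*} [DecidableEq V] (G : SimpleGraph V)
    (F : Finset G.Subgraph) : Prop :=
  (∀ C ∈ F, IsHamiltonCycle G C) ∧ ∀ e ∈ G.edgeSet, ∃ C ∈ F, e ∈ C.edgeSet

end HamiltonCovering

/-! Every cycle of the packing uses two edges at each vertex, so the uncovered edges form a graph of
maximum degree at most `Δ - 2h`. A greedy edge colouring splits them into at most `2 (Δ - 2h)`
matchings. It remains to cover one matching by `O(1/α)` Hamilton cycles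
(`IsExpander.exists_cover_matching`); the resulting bound is linear in `1/α`, hence stronger than
the one claimed.

The matching is divided into `⌈131/α⌉` pieces of size at most `α n / 130`, and independently into 81
colour classes. A union bound (`exists_splitting_colouring`) supplies colours for which every small
set keeps at least half of its neighbors unmatched by each class. The same then holds for every
class intersected with a piece, and each such submatching `m` lies on one Hamilton cycle
(`exists_isHamiltonCycle_containing`).

That cycle comes from Pósa rotations on a longest path containing every edge of `m` that it touches.
Pivots are unmatched, so no edge of `m` is ever broken. Expansion makes the set of reachable ends
grow to `n / 4` after `T = ⌈2/α⌉ + 2` rotations (`IsExpander.growth`). Fix `2T + 3` disjoint long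
segments of the path. After at most `T` rotations at each end at least three are unbroken, and two
of these can be separated by one cut. Few ends are bad for any segment, so both ends can be chosen
good. Rotating each half with pivots inside its own segment then gives at least `l` new ends on each
side, and property `L` joins two of them. The closed cycle is Hamiltonian, since otherwise
connectivity would yield a longer path. -/

namespace HamiltonCovering

/-! ### Paths as vertex lists, and Pósa rotations. -/

section Rotations

variable {V : Type*}

/-- The edges of the path traversing the vertices of a list in order. -/
def pathEdges : List V → List (Sym2 V)
  | [] => []
  | [_] => []
  | a :: b :: l => s(a, b) :: pathEdges (b :: l)

@[simp] theorem pathEdges_nil : pathEdges ([] : List V) = [] := rfl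
@[simp] theorem pathEdges_singleton (a : V) : pathEdges [a] = [] := rfl
@[simp] theorem pathEdges_cons_cons (a b : V) (l : List V) :
    pathEdges (a :: b :: l) = s(a, b) :: pathEdges (b :: l) := rfl

theorem pathEdges_append (a : List V) (w v : V) (b : List V) :
    pathEdges (a ++ w :: v :: b) = pathEdges (a ++ [w]) ++ s(w, v) :: pathEdges (v :: b) := by
  induction a with
  | nil => simp
  | cons x a ih =>
    cases a with
    | nil => simp
    | cons y a => simpa using ih

theorem mem_pathEdges_reverse {e : Sym2 V} {p : List V} :
    e ∈ pathEdges p.reverse ↔ e ∈ pathEdges p := by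
  induction p with
  | nil => simp
  | cons x p ih =>
    cases p with
    | nil => simp
    | cons y p =>
      have : (x :: y :: p).reverse = p.reverse ++ y :: x :: [] := by simp
      rw [this, pathEdges_append]
      have h2 : p.reverse ++ [y] = (y :: p).reverse := by simp
      rw [h2, List.mem_append, ih]
      simp [Sym2.eq_swap, or_comm]

theorem mem_of_mem_pathEdges {e : Sym2 V} {p : List V} (h : e ∈ pathEdges p) {v : V}
    (hv : v ∈ e) : v ∈ p := by
  induction p with
  | nil => simp at h
  | cons x p ih =>
    cases p with
    | nil => simp at h
    | cons y p =>
      rw [pathEdges_cons_cons, List.mem_cons] at h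
      rcases h with rfl | h
      · rcases Sym2.mem_iff.1 hv with rfl | rfl <;> simp
      · exact List.mem_cons_of_mem _ (ih h)

theorem exists_of_mem_pathEdges {e : Sym2 V} {p : List V} (h : e ∈ pathEdges p) :
    ∃ c u v d, p = c ++ u :: v :: d ∧ e = s(u, v) := by
  induction p with
  | nil => simp at h
  | cons x p ih =>
    cases p with
    | nil => simp at h
    | cons y p =>
      rw [pathEdges_cons_cons, List.mem_cons] at h
      rcases h with rfl | h
      · exact ⟨[], x, y, p, rfl, rfl⟩
      · obtain ⟨c, u, v, d, h1, h2⟩ := ih h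
        exact ⟨x :: c, u, v, d, by rw [h1]; rfl, h2⟩

theorem pathEdges_infix {p q : List V} (h : p <:+: q) : ∀ e ∈ pathEdges p, e ∈ pathEdges q := by
  obtain ⟨a, b, rfl⟩ := h
  intro e he
  obtain ⟨c, u, v, d, rfl, rfl⟩ := exists_of_mem_pathEdges he
  have : a ++ (c ++ u :: v :: d) ++ b = (a ++ c) ++ u :: v :: (d ++ b) := by simp
  rw [this, pathEdges_append]
  simp

/-- Edges of a concatenation lie in one of the two parts or join their ends. -/
theorem mem_pathEdges_append {q r : List V} {e : Sym2 V} (h : e ∈ pathEdges (q ++ r)) :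
    e ∈ pathEdges q ∨ e ∈ pathEdges r ∨
      ∃ w ∈ q.getLast?, ∃ v ∈ r.head?, e = s(w, v) := by
  rcases List.eq_nil_or_concat q with rfl | ⟨q, w, rfl⟩
  · simp at h; simp [h]
  · cases r with
    | nil => simp at h; simp [h]
    | cons v r =>
      have : q.concat w ++ v :: r = q ++ w :: v :: r := by simp
      rw [this, pathEdges_append] at h
      simp only [List.mem_append, List.mem_cons] at h
      rcases h with h | h | h
      · left; simpa using h
      · right; right; simp [h]
      · right; left; exact h

/-- Each vertex of `X` has at most one successor and one predecessor on a path. -/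
theorem pathEdges_neighbors_card {p : List V} (hp : p.Nodup) (A X : Finset V)
    (hA : ∀ v ∈ A, ∃ w ∈ X, s(v, w) ∈ pathEdges p) : A.card ≤ 2 * X.card := by
  classical
  -- Successor and predecessor along `p`. The default `w` and the truncated subtraction at index 0
  -- only add harmless values, as just an inclusion into the two images is needed.
  let f : V → V := fun w => (p[p.idxOf w + 1]?).getD w
  let g : V → V := fun w => (p[p.idxOf w - 1]?).getD w
  have hsub : A ⊆ X.image f ∪ X.image g := by
    intro v hv
    obtain ⟨w, hw, he⟩ := hA v hv
    obtain ⟨c, x, y, d, rfl, h2⟩ := exists_of_mem_pathEdges he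
    have hnd := hp
    rw [List.nodup_append] at hnd
    obtain ⟨hc, hd, hcd⟩ := hnd
    have hxc : x ∉ c := fun h => hcd x h x (by simp) rfl
    have hyc : y ∉ c := fun h => hcd y h y (by simp) rfl
    have hxy : x ≠ y := by
      rintro rfl; simp at hd
    rw [Finset.mem_union, Finset.mem_image, Finset.mem_image]
    rw [Sym2.eq_iff] at h2
    rcases h2 with ⟨rfl, rfl⟩ | ⟨rfl, rfl⟩
    · right
      refine ⟨w, hw, ?_⟩
      simp only [g]
      rw [List.idxOf_append_of_notMem hyc]
      simp [List.idxOf_cons_ne _ hxy]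
    · left
      refine ⟨w, hw, ?_⟩
      simp only [f]
      rw [List.idxOf_append_of_notMem hxc]
      simp
  calc _ ≤ _ := Finset.card_le_card hsub
    _ ≤ _ := Finset.card_union_le _ _
    _ ≤ X.card + X.card := Nat.add_le_add Finset.card_image_le Finset.card_image_le
    _ = _ := by ring

variable (G : SimpleGraph V) (Q : Set V)

/-- A rotation of the path `p` at its first vertex, with pivot in `Q`. -/
def Rotation (p p' : List V) : Prop :=
  ∃ (y : V) (a : List V) (v : V) (b : List V), v ∈ Q ∧ G.Adj y v ∧
    p = y :: a ++ v :: b ∧ p' = (y :: a).reverse ++ v :: b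

/-- Reachability by at most `t` rotations. -/
def Reach : ℕ → List V → List V → Prop
  | 0 => fun p p' => p = p'
  | t + 1 => fun p p' => Reach t p p' ∨ ∃ p₁, Reach t p p₁ ∧ Rotation G Q p₁ p'

variable {G Q}

theorem Reach.mono {s t : ℕ} (hst : s ≤ t) {p p' : List V} (h : Reach G Q s p p') :
    Reach G Q t p p' := by
  induction hst with
  | refl => exact h
  | step _ ih => exact Or.inl ih

/-- A rotation trades exactly one edge: the broken edge `s(w, v)` runs from the pivot to the new
end, the added edge `s(y, v)` from the old end to the pivot. -/
theorem Rotation.edges {p p' : List V} (h : Rotation G Q p p') :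
    ∃ y w v, p.head? = some y ∧ p'.head? = some w ∧ v ∈ Q ∧ s(w, v) ∈ pathEdges p ∧
      (∀ e ∈ pathEdges p, e ≠ s(w, v) → e ∈ pathEdges p') ∧
      (∀ e ∈ pathEdges p', e ≠ s(y, v) → e ∈ pathEdges p) := by
  obtain ⟨y, a, v, b, hv, -, rfl, rfl⟩ := h
  obtain ⟨a', w, hw⟩ : ∃ a' w, y :: a = a' ++ [w] := by
    rcases List.eq_nil_or_concat (y :: a) with h | ⟨a', w, h⟩
    · simp at h
    · exact ⟨a', w, by simpa using h⟩
  have hp : y :: a ++ v :: b = a' ++ w :: v :: b := by rw [hw]; simp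
  have hp' : (y :: a).reverse ++ v :: b = a.reverse ++ y :: v :: b := by simp
  have hrev : ∀ e, e ∈ pathEdges (a.reverse ++ [y]) ↔ e ∈ pathEdges (a' ++ [w]) := by
    intro e
    rw [← hw, ← List.reverse_cons, mem_pathEdges_reverse]
  refine ⟨y, w, v, by simp, by rw [hw]; simp, hv, ?_, ?_, ?_⟩
  · rw [hp, pathEdges_append]; simp
  · intro e he hne
    rw [hp, pathEdges_append] at he
    rw [hp', pathEdges_append]
    simp only [List.mem_append, List.mem_cons, hrev] at he ⊢
    tauto
  · intro e he hne
    rw [hp', pathEdges_append] at he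
    rw [hp, pathEdges_append]
    simp only [List.mem_append, List.mem_cons, hrev] at he ⊢
    tauto

theorem exists_rotation {p : List V} {y v : V} (hy : p.head? = some y) (hv : v ∈ Q)
    (hvp : v ∈ p) (hadj : G.Adj y v) :
    ∃ w p', Rotation G Q p p' ∧ p'.head? = some w ∧ s(w, v) ∈ pathEdges p := by
  obtain ⟨a, b, rfl⟩ := List.append_of_mem hvp
  cases a with
  | nil =>
    simp at hy
    exact absurd hy.symm hadj.ne
  | cons z a =>
    simp at hy
    subst hy
    obtain ⟨a', w, hw⟩ : ∃ a' w, z :: a = a' ++ [w] := by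
      rcases List.eq_nil_or_concat (z :: a) with h | ⟨a', w, h⟩
      · simp at h
      · exact ⟨a', w, by simpa using h⟩
    refine ⟨w, _, ⟨z, a, v, b, hv, hadj, rfl, rfl⟩, by rw [hw]; simp, ?_⟩
    have hp : z :: a ++ v :: b = a' ++ w :: v :: b := by rw [hw]; simp
    rw [hp, pathEdges_append]
    simp

theorem Rotation.perm {p p' : List V} (h : Rotation G Q p p') : p'.Perm p := by
  obtain ⟨y, a, v, b, hv, -, rfl, rfl⟩ := h
  exact (List.reverse_perm _).append_right _

theorem Rotation.getLast? {p p' : List V} (h : Rotation G Q p p') : p'.getLast? = p.getLast? := by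
  obtain ⟨y, a, v, b, hv, -, rfl, rfl⟩ := h
  rw [List.getLast?_append_of_ne_nil _ (by simp), List.getLast?_append_of_ne_nil _ (by simp)]

theorem Rotation.isChain {p p' : List V} (h : Rotation G Q p p') (hp : p.IsChain G.Adj) :
    p'.IsChain G.Adj := by
  obtain ⟨y, a, v, b, hv, hadj, rfl, rfl⟩ := h
  rw [List.isChain_append] at hp ⊢
  refine ⟨?_, hp.2.1, ?_⟩
  · rw [List.isChain_reverse]
    exact hp.1.imp fun _ _ h => h.symm
  · intro x hx z hz
    simp at hx hz
    subst hx hz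
    exact hadj

theorem Rotation.append {p p' : List V} (h : Rotation G Q p p') (r : List V) :
    Rotation G Q (p ++ r) (p' ++ r) := by
  obtain ⟨y, a, v, b, hv, hadj, rfl, rfl⟩ := h
  exact ⟨y, a, v, b ++ r, hv, hadj, by simp, by simp⟩

theorem Reach.induction {t : ℕ} {p p' : List V} (h : Reach G Q t p p') (C : List V → Prop)
    (h0 : C p) (h1 : ∀ p₁ p₂, C p₁ → Rotation G Q p₁ p₂ → C p₂) : C p' := by
  induction t generalizing p' with
  | zero => exact (show p = p' from h) ▸ h0
  | succ t ih =>
    rcases h with h | ⟨p₁, h, hr⟩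
    · exact ih h
    · exact h1 _ _ (ih h) hr

theorem Reach.perm {t : ℕ} {p p' : List V} (h : Reach G Q t p p') : p'.Perm p :=
  h.induction (fun q => q.Perm p) (List.Perm.refl _) fun _ _ h1 h2 => h2.perm.trans h1

theorem Reach.getLast? {t : ℕ} {p p' : List V} (h : Reach G Q t p p') :
    p'.getLast? = p.getLast? :=
  h.induction (fun q => q.getLast? = p.getLast?) rfl fun _ _ h1 h2 => h2.getLast?.trans h1

/-- At most `t` edges are lost by `t` rotations. -/
theorem Reach.lost_edges [DecidableEq V] {t : ℕ} {p p' : List V} (h : Reach G Q t p p') :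
    ∃ S : Finset (Sym2 V), S.card ≤ t ∧ ∀ e ∈ pathEdges p, e ∉ S → e ∈ pathEdges p' := by
  induction t generalizing p' with
  | zero =>
    have h : p = p' := h
    exact ⟨∅, by simp, fun e he _ => h ▸ he⟩
  | succ t ih =>
    rcases h with h | ⟨p₁, h, hr⟩
    · obtain ⟨S, h1, h2⟩ := ih h
      exact ⟨S, by omega, h2⟩
    · obtain ⟨S, h1, h2⟩ := ih h
      obtain ⟨y, w, v, -, -, -, -, h3, -⟩ := hr.edges
      refine ⟨insert s(w, v) S, (Finset.card_insert_le _ _).trans (by omega), ?_⟩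
      intro e he hS
      rw [Finset.mem_insert, not_or] at hS
      exact h3 e (h2 e he hS.2) hS.1

section Heads

variable [Fintype V]

variable (G Q) in
open Classical in
/-- The first vertices of the paths that can be reached by at most `t` rotations. -/
noncomputable def heads (t : ℕ) (p : List V) : Finset V :=
  Finset.univ.filter fun x => ∃ p', Reach G Q t p p' ∧ p'.head? = some x

theorem mem_heads {t : ℕ} {p : List V} {x : V} :
    x ∈ heads G Q t p ↔ ∃ p', Reach G Q t p p' ∧ p'.head? = some x := by
  simp [heads]

theorem heads_mono (p : List V) : Monotone fun t => heads G Q t p := by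
  intro s t hst x hx
  obtain ⟨p', h1, h2⟩ := mem_heads.1 hx
  exact mem_heads.2 ⟨p', h1.mono hst, h2⟩

/-- A vertex which is neither reached nor next to a reached vertex keeps its path edges. -/
theorem Reach.edges_at {t : ℕ} {p : List V} {v : V} (hv : v ∉ heads G Q t p)
    (hn : ∀ w ∈ heads G Q t p, s(v, w) ∉ pathEdges p) {i : ℕ} (hi : i ≤ t) {p' : List V}
    (h : Reach G Q i p p') (e : Sym2 V) (he : v ∈ e) : e ∈ pathEdges p' ↔ e ∈ pathEdges p := by
  induction i generalizing p' e with
  | zero =>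
    have h : p = p' := h
    rw [h]
  | succ i ih =>
    rcases h with h | ⟨p₁, h, hr⟩
    · exact ih (by omega) h e he
    · rw [← ih (by omega) h e he]
      obtain ⟨y, w, x, hy, hw, hx, hwx, h3, h4⟩ := hr.edges
      have hyH : y ∈ heads G Q t p := mem_heads.2 ⟨p₁, h.mono (by omega), hy⟩
      have hwH : w ∈ heads G Q t p :=
        mem_heads.2 ⟨p', Reach.mono hi (Or.inr ⟨p₁, h, hr⟩), hw⟩
      -- Were `v` the pivot, the broken edge would by induction be an edge of the initial path,
      -- making `v` adjacent on it to the reached end `w`.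
      have hvx : v ≠ x := by
        rintro rfl
        refine hn w hwH ?_
        rw [Sym2.eq_swap]
        exact (ih (by omega) h _ (by simp)).1 hwx
      have hvy : v ≠ y := fun h => hv (h ▸ hyH)
      have hvw : v ≠ w := fun h => hv (h ▸ hwH)
      constructor
      · intro h
        refine h4 e h ?_
        rintro rfl
        simp [hvx, hvy] at he
      · intro h
        refine h3 e h ?_
        rintro rfl
        simp [hvx, hvw] at he

/-- Pósa's argument: if the conclusion fails, `v` still has its initial path edges when `y` becomes
the end, so the rotation with pivot `v` makes an initial path neighbor of `v` an end. -/
theorem heads_expand {t : ℕ} {p : List V} {y v : V} (hy : y ∈ heads G Q t p) (hv : v ∈ Q)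
    (hvp : v ∈ p) (hadj : G.Adj y v) :
    v ∈ heads G Q t p ∨ ∃ w ∈ heads G Q (t + 1) p, s(v, w) ∈ pathEdges p := by
  by_contra! hcon
  obtain ⟨h1, h2⟩ := hcon
  have h3 : ∀ w ∈ heads G Q t p, s(v, w) ∉ pathEdges p :=
    fun w hw => h2 w (heads_mono p (Nat.le_succ t) hw)
  obtain ⟨p', hr, hy⟩ := mem_heads.1 hy
  obtain ⟨w, p₂, hrot, hw, he⟩ := exists_rotation hy hv (hr.perm.mem_iff.2 hvp) hadj
  refine h2 w (mem_heads.2 ⟨p₂, Or.inr ⟨p', hr, hrot⟩, hw⟩) ?_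
  rw [Sym2.eq_swap]
  exact (hr.edges_at h1 h3 le_rfl _ (by simp)).1 he

/-- By `heads_expand` such vertices are reached ends or path neighbors of reached ends, and there
are at most two path neighbors per end; hence the factor `1 + 2`. -/
theorem heads_neighbors_card {t : ℕ} {p : List V} (hp : p.Nodup) (A : Finset V)
    (hA : ∀ v ∈ A, v ∈ Q ∧ v ∈ p ∧ ∃ y ∈ heads G Q t p, G.Adj y v) :
    A.card ≤ 3 * (heads G Q (t + 1) p).card := by
  classical
  have hsub : A ⊆ heads G Q (t + 1) p ∪
      Finset.univ.filter fun v => ∃ w ∈ heads G Q (t + 1) p, s(v, w) ∈ pathEdges p := by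
    intro v hv
    obtain ⟨h1, h2, y, hy, hadj⟩ := hA v hv
    rcases heads_expand hy h1 h2 hadj with h | h
    · exact Finset.mem_union_left _ (heads_mono p (Nat.le_succ t) h)
    · exact Finset.mem_union_right _ (by simpa using h)
  have h1 := Finset.card_le_card hsub
  have h2 := Finset.card_union_le (heads G Q (t + 1) p)
    (Finset.univ.filter fun v => ∃ w ∈ heads G Q (t + 1) p, s(v, w) ∈ pathEdges p)
  have h3 := pathEdges_neighbors_card hp
    (Finset.univ.filter fun v => ∃ w ∈ heads G Q (t + 1) p, s(v, w) ∈ pathEdges p)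
    (heads G Q (t + 1) p) (by simp)
  omega

end Heads

end Rotations


/-! ### Longest paths respecting a matching, and closing them into cycles. -/

section GoodPaths

variable {V : Type*}

/-- The edges of `m` are pairwise disjoint. -/
def PairwiseDisjointEdges (m : Finset (Sym2 V)) : Prop :=
  ∀ e ∈ m, ∀ f ∈ m, ∀ v, v ∈ e → v ∈ f → e = f

/-- The vertices that lie on no edge of `m`. -/
def unmatched (m : Finset (Sym2 V)) : Set V := {v | ∀ e ∈ m, v ∉ e}

/-- The list `p` is a path of `G` traversing every edge of `m` that it meets. -/
structure IsGoodPath (G : SimpleGraph V) (m : Finset (Sym2 V)) (p : List V) : Prop where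
  nodup : p.Nodup
  isChain : p.IsChain G.Adj
  traverses : ∀ e ∈ m, ∀ v ∈ e, v ∈ p → e ∈ pathEdges p

variable {G : SimpleGraph V} {m : Finset (Sym2 V)} {p : List V}

theorem IsGoodPath.of_perm {p' : List V} (h : IsGoodPath G m p) (hp : p'.Perm p)
    (hc : p'.IsChain G.Adj) (he : ∀ e ∈ m, e ∈ pathEdges p → e ∈ pathEdges p') :
    IsGoodPath G m p' :=
  ⟨hp.nodup_iff.2 h.nodup, hc,
    fun e hem v hv hvp => he e hem (h.traverses e hem v hv (hp.mem_iff.1 hvp))⟩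

theorem isChain_adj_reverse (h : p.IsChain G.Adj) : p.reverse.IsChain G.Adj := by
  rw [List.isChain_reverse]
  exact h.imp fun _ _ h => h.symm

theorem IsGoodPath.reverse (h : IsGoodPath G m p) : IsGoodPath G m p.reverse :=
  h.of_perm (List.reverse_perm p) (isChain_adj_reverse h.isChain)
    fun _ _ he => mem_pathEdges_reverse.2 he

/-- The broken edge contains the pivot, which is unmatched, so it is not in `m`. -/
theorem IsGoodPath.rotation {Q : Set V} (hQ : Q ⊆ unmatched m) {p' : List V}
    (h : IsGoodPath G m p) (hr : Rotation G Q p p') : IsGoodPath G m p' := by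
  refine h.of_perm hr.perm (hr.isChain h.isChain) fun e hem he => ?_
  obtain ⟨y, w, v, -, -, hv, -, h3, -⟩ := hr.edges
  refine h3 e he ?_
  rintro rfl
  exact hQ hv _ hem (by simp)

theorem IsGoodPath.reach {Q : Set V} (hQ : Q ⊆ unmatched m) {t : ℕ} {p' : List V}
    (h : IsGoodPath G m p) (hr : Reach G Q t p p') : IsGoodPath G m p' :=
  hr.induction (IsGoodPath G m) h fun _ _ h1 h2 => h1.rotation hQ h2

/-- Rotations inside the front part `q` are rotations of the whole path that leave `r` untouched.
This lets the two ends be rotated independently after a cut. -/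
theorem IsGoodPath.reach_append {Q : Set V} (hQ : Q ⊆ unmatched m) {t : ℕ} {q q' r : List V}
    (h : IsGoodPath G m (q ++ r)) (hr : Reach G Q t q q') : IsGoodPath G m (q' ++ r) :=
  hr.induction (fun q => IsGoodPath G m (q ++ r)) h fun _ _ h1 h2 => h1.rotation hQ (h2.append r)

/-- A path through the vertices of a list. -/
theorem exists_walk_of_isChain (x : V) (p : List V) (h : (x :: p).IsChain G.Adj) :
    ∃ y, (x :: p).getLast? = some y ∧ ∃ w : G.Walk x y, w.support = x :: p ∧
      w.edges = pathEdges (x :: p) := by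
  induction p generalizing x with
  | nil => exact ⟨x, rfl, SimpleGraph.Walk.nil, rfl, rfl⟩
  | cons z p ih =>
    rw [List.isChain_cons_cons] at h
    obtain ⟨y, h1, w, h2, h3⟩ := ih z h.2
    refine ⟨y, by rw [List.getLast?_cons_cons, h1], SimpleGraph.Walk.cons h.1 w, ?_, ?_⟩
    · simp [h2]
    · simp [h3]

theorem isHamiltonCycle_of_list [DecidableEq V] (hp : p.Nodup) (hc : p.IsChain G.Adj)
    (hmem : ∀ v, v ∈ p) (h3 : 3 ≤ p.length) {x y : V} (hx : p.head? = some x)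
    (hy : p.getLast? = some y) (hadj : G.Adj y x) :
    ∃ C : G.Subgraph, IsHamiltonCycle G C ∧ ∀ e ∈ pathEdges p, e ∈ C.edgeSet := by
  match p, hx with
  | x' :: p, hx =>
    simp at hx
    subst hx
    obtain ⟨y', hy', w, hw1, hw2⟩ := exists_walk_of_isChain x' p hc
    obtain rfl : y = y' := by rw [hy] at hy'; simpa using hy'
    have hpath : w.IsPath := by rw [SimpleGraph.Walk.isPath_def, hw1]; exact hp
    have hcyc : (SimpleGraph.Walk.cons hadj w).IsCycle := by
      rw [SimpleGraph.Walk.cons_isCycle_iff]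
      refine ⟨hpath, ?_⟩
      rw [hw2]
      match p, h3 with
      | z :: z' :: p, _ =>
        intro hmem
        rw [pathEdges_cons_cons, List.mem_cons] at hmem
        rw [List.nodup_cons, List.nodup_cons] at hp
        rcases hmem with h | h
        · have : y = z := by
            rw [Sym2.eq_iff] at h
            rcases h with h | h
            · exact absurd h.1 hadj.ne
            · exact h.1
          subst this
          rw [List.getLast?_cons_cons, List.getLast?_cons_cons] at hy
          exact hp.2.1 (List.mem_of_getLast? hy)
        · exact hp.1 (mem_of_mem_pathEdges h (by simp))
    refine ⟨(SimpleGraph.Walk.cons hadj w).toSubgraph, ⟨y, _, ?_, rfl⟩, ?_⟩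
    · rw [SimpleGraph.Walk.isHamiltonianCycle_iff_isCycle_and_support_count_tail_eq_one]
      refine ⟨hcyc, fun a => ?_⟩
      simp only [SimpleGraph.Walk.support_cons, List.tail_cons, hw1]
      exact List.count_eq_one_of_mem hp (hmem a)
    · intro e he
      rw [SimpleGraph.Walk.mem_edges_toSubgraph]
      simp [hw2, he]

/-- A good path of maximum length. -/
structure IsMaxGoodPath (G : SimpleGraph V) (m : Finset (Sym2 V)) (p : List V) : Prop where
  good : IsGoodPath G m p
  le : ∀ p', IsGoodPath G m p' → p'.length ≤ p.length

theorem exists_isMaxGoodPath [Fintype V] (G : SimpleGraph V) (m : Finset (Sym2 V)) :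
    ∃ p, IsMaxGoodPath G m p := by
  have h0 : IsGoodPath G m ([] : List V) := ⟨by simp, by simp, by simp⟩
  have hb : ∀ k, (∃ p, IsGoodPath G m p ∧ p.length = k) → k ≤ Fintype.card V := by
    rintro k ⟨p, hp, rfl⟩
    exact hp.nodup.length_le_card
  classical
  obtain ⟨p, h1, h2⟩ := Nat.findGreatest_spec (P := fun k => ∃ p, IsGoodPath G m p ∧ p.length = k)
    (Nat.zero_le (Fintype.card V)) ⟨[], h0, rfl⟩
  refine ⟨p, h1, fun p' hp' => ?_⟩
  rw [h2]
  exact Nat.le_findGreatest (hb _ ⟨p', hp', rfl⟩) ⟨p', hp', rfl⟩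

theorem IsMaxGoodPath.of_perm {p' : List V} (h : IsMaxGoodPath G m p) (hp : p'.Perm p)
    (hg : IsGoodPath G m p') : IsMaxGoodPath G m p' :=
  ⟨hg, fun q hq => (h.le q hq).trans hp.length_eq.ge⟩

/-- A neighbor `v` off the path would extend it: by `v` alone if `v` is unmatched, and otherwise by
`v` followed by its partner, which is off the path too because the path is good. -/
theorem IsMaxGoodPath.neighbor_mem (hm : PairwiseDisjointEdges m) (hmG : ∀ e ∈ m, e ∈ G.edgeSet)
    (h : IsMaxGoodPath G m p) {y v : V} (hy : p.head? = some y) (hadj : G.Adj y v) : v ∈ p := by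
  match p, hy with
  | y' :: p, hy =>
    simp at hy
    subst hy
    by_contra hv
    by_cases hvm : v ∈ unmatched m
    · have hg : IsGoodPath G m (v :: y' :: p) := by
        refine ⟨List.nodup_cons.2 ⟨hv, h.good.nodup⟩,
          List.isChain_cons_cons.2 ⟨hadj.symm, h.good.isChain⟩, fun e he u hu hup => ?_⟩
        rw [List.mem_cons] at hup
        rcases hup with rfl | hup
        · exact absurd hu (hvm e he)
        · rw [pathEdges_cons_cons]
          exact List.mem_cons_of_mem _ (h.good.traverses e he u hu hup)
      have := h.le _ hg
      simp at this
    · simp only [unmatched, Set.mem_ofPred_eq, not_forall, not_not] at hvm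
      obtain ⟨e, he, hve⟩ := hvm
      obtain ⟨w, rfl⟩ := Sym2.mem_iff_exists.1 hve
      have hvw : G.Adj v w := hmG _ he
      have hw : w ∉ y' :: p := fun hw =>
        hv (mem_of_mem_pathEdges (h.good.traverses _ he w (by simp) hw) (by simp))
      have hg : IsGoodPath G m (w :: v :: y' :: p) := by
        refine ⟨List.nodup_cons.2 ⟨?_, List.nodup_cons.2 ⟨hv, h.good.nodup⟩⟩,
          List.isChain_cons_cons.2 ⟨hvw.symm,
            List.isChain_cons_cons.2 ⟨hadj.symm, h.good.isChain⟩⟩, fun f hf u hu hup => ?_⟩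
        · rw [List.mem_cons, not_or]
          exact ⟨hvw.ne', hw⟩
        · rw [pathEdges_cons_cons, pathEdges_cons_cons]
          rw [List.mem_cons, List.mem_cons] at hup
          rcases hup with rfl | rfl | hup
          · rw [hm f hf _ he u hu (by simp)]
            simp [Sym2.eq_swap]
          · rw [hm f hf _ he u hu (by simp)]
            simp [Sym2.eq_swap]
          · exact List.mem_cons_of_mem _ (List.mem_cons_of_mem _ (h.good.traverses f hf u hu hup))
      have := h.le _ hg
      simp at this

/-- If the ends of a maximum good path are adjacent, then it contains all the vertices. -/
theorem IsMaxGoodPath.mem_of_adj (hm : PairwiseDisjointEdges m) (hmG : ∀ e ∈ m, e ∈ G.edgeSet)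
    (hconn : ∀ A : Set V, A.Nonempty → A ≠ Set.univ → ∃ u ∈ A, ∃ z ∉ A, G.Adj u z)
    (h : IsMaxGoodPath G m p) {x y : V} (hx : p.head? = some x)
    (hy : p.getLast? = some y) (hadj : G.Adj y x) (v : V) : v ∈ p := by
  by_contra hv
  obtain ⟨u, hu, z, hz, huz⟩ := hconn {v | v ∈ p} ⟨x, List.mem_of_head? hx⟩
    (fun h => hv (h.symm ▸ Set.mem_univ v : v ∈ {v | v ∈ p}))
  have hz : z ∉ p := hz
  obtain ⟨a, b, rfl⟩ := List.append_of_mem (show u ∈ p from hu)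
  have key : ∀ p', p'.Perm (a ++ u :: b) → p'.head? = some u → p'.IsChain G.Adj →
      (∀ e ∈ m, e ∈ pathEdges (a ++ u :: b) → e ∈ pathEdges p') → False := by
    intro p' h1 h2 h3 h4
    have h5 := h.of_perm h1 (h.good.of_perm h1 h3 h4)
    exact hz (h1.mem_iff.1 (h5.neighbor_mem hm hmG h2 huz))
  have hch := List.isChain_append.1 h.good.isChain
  rcases List.eq_nil_or_concat a with rfl | ⟨a, w, rfl⟩
  · exact hz (h.neighbor_mem hm hmG (by simp) huz)
  simp only [List.concat_eq_append] at *
  -- The ends are adjacent, so the path closes to a cycle, which is reopened next to `u` by deleting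
  -- an edge outside `m`. If the edge before `u` is in `m`, the one after it is not, the edges of
  -- `m` being disjoint.
  by_cases hwu : s(w, u) ∈ m
  · refine key ((a ++ [w] ++ [u]).reverse ++ b.reverse) ?_ (by simp) ?_ ?_
    · refine ((List.reverse_perm _).append (List.reverse_perm _)).trans ?_
      simp
    · rw [List.isChain_append]
      refine ⟨?_, isChain_adj_reverse hch.2.1.tail, ?_⟩
      · refine isChain_adj_reverse (h.good.isChain.infix ?_)
        exact ⟨[], b, by simp⟩
      · intro s hs t ht
        rcases List.eq_nil_or_concat b with rfl | ⟨b, c, rfl⟩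
        · simp at ht
        · have e1 : c = y := by
            rw [List.concat_eq_append, ← List.cons_append, ← List.append_assoc,
              List.getLast?_concat] at hy
            simpa using hy
          have e2 : c = t := by simpa using ht
          have e3 : s = x := by
            rw [List.getLast?_reverse] at hs
            simp only [List.append_assoc, List.head?_append] at hs hx
            cases a <;> simp_all
          rw [← e2, e1, e3]
          exact hadj.symm
    · intro e he hep
      have h1 : a ++ [w] ++ u :: b = (a ++ [w]) ++ [u] ++ b := by simp
      cases b with
      | nil => rw [h1] at hep; simpa [mem_pathEdges_reverse] using mem_pathEdges_reverse.2 hep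
      | cons c b =>
        rw [pathEdges_append] at hep
        rw [List.mem_append, List.mem_cons] at hep
        rcases hep with hep | rfl | hep
        · exact pathEdges_infix (List.prefix_append _ _).isInfix _ (mem_pathEdges_reverse.2 hep)
        · exfalso
          have := hm _ he _ hwu u (by simp) (by simp)
          have hnd := h.good.nodup
          have hcw : c = w := by
            rw [Sym2.eq_swap] at this
            rcases Sym2.eq_iff.1 this with h | h
            · exact h.1
            · exact h.1.trans h.2
          subst hcw
          simp [List.nodup_append] at hnd
        · exact pathEdges_infix (List.suffix_append _ _).isInfix _ (mem_pathEdges_reverse.2 hep)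
  · refine key (u :: b ++ (a ++ [w])) List.perm_append_comm (by simp) ?_ ?_
    · rw [List.isChain_append]
      refine ⟨hch.2.1, hch.1, ?_⟩
      intro s hs t ht
      have e1 : s = y := by
        rw [List.getLast?_append_of_ne_nil _ (by simp)] at hy
        rw [hy] at hs
        simpa using hs.symm
      have e2 : t = x := by
        rw [List.head?_append_of_ne_nil _ (by simp)] at hx
        rw [hx] at ht
        simpa using ht.symm
      rw [e1, e2]
      exact hadj
    · intro e he hep
      have h1 : a ++ [w] ++ u :: b = a ++ w :: u :: b := by simp
      rw [h1, pathEdges_append, List.mem_append, List.mem_cons] at hep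
      rcases hep with hep | rfl | hep
      · exact pathEdges_infix (List.suffix_append _ _).isInfix _ hep
      · exact absurd he hwu
      · exact pathEdges_infix (List.prefix_append _ _).isInfix _ hep

theorem IsMaxGoodPath.exists_isHamiltonCycle [DecidableEq V] (hm : PairwiseDisjointEdges m)
    (hmG : ∀ e ∈ m, e ∈ G.edgeSet)
    (hconn : ∀ A : Set V, A.Nonempty → A ≠ Set.univ → ∃ u ∈ A, ∃ z ∉ A, G.Adj u z)
    (h : IsMaxGoodPath G m p) (h3 : 3 ≤ p.length) {x y : V} (hx : p.head? = some x)
    (hy : p.getLast? = some y) (hadj : G.Adj y x) :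
    ∃ C : G.Subgraph, IsHamiltonCycle G C ∧ ∀ e ∈ m, e ∈ C.edgeSet := by
  have hmem := h.mem_of_adj hm hmG hconn hx hy hadj
  obtain ⟨C, hC, he⟩ := isHamiltonCycle_of_list h.good.nodup h.good.isChain hmem h3 hx hy hadj
  refine ⟨C, hC, fun e hem => he e ?_⟩
  induction e with
  | _ a b => exact h.good.traverses _ hem a (by simp) (hmem a)

end GoodPaths


/-! ### Rotations with pivots inside a fixed segment. -/

section Segments

variable {V : Type*} {G : SimpleGraph V} {m : Finset (Sym2 V)}

/-- The unmatched vertices in the interior of the path `I`. -/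
def innerPivots (m : Finset (Sym2 V)) (I : List V) : Set V :=
  {v | v ∈ unmatched m ∧ ∃ c w₁ w₂ d, I = c ++ w₁ :: v :: w₂ :: d}

/-- Every inner pivot of `I` with a neighbor in `X` is in `X` or next to a vertex of `X`
along `I`. -/
def IsRotationClosed (G : SimpleGraph V) (m : Finset (Sym2 V)) (I : List V) (X : Finset V) : Prop :=
  ∀ x ∈ X, ∀ v ∈ innerPivots m I, G.Adj x v → v ∈ X ∨ ∃ w ∈ X, s(v, w) ∈ pathEdges I

theorem IsRotationClosed.union [DecidableEq V] {I : List V} {X Y : Finset V}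
    (hX : IsRotationClosed G m I X)
    (hY : IsRotationClosed G m I Y) : IsRotationClosed G m I (X ∪ Y) := by
  intro x hx v hv hadj
  rcases Finset.mem_union.1 hx with hx | hx
  · rcases hX x hx v hv hadj with h | ⟨w, hw, h⟩
    · exact Or.inl (Finset.mem_union_left _ h)
    · exact Or.inr ⟨w, Finset.mem_union_left _ hw, h⟩
  · rcases hY x hx v hv hadj with h | ⟨w, hw, h⟩
    · exact Or.inl (Finset.mem_union_right _ h)
    · exact Or.inr ⟨w, Finset.mem_union_right _ hw, h⟩

theorem card_matched_le [Fintype V] [DecidableEq V] (m : Finset (Sym2 V)) (A : Finset V)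
    (hA : ∀ v ∈ A, v ∉ unmatched m) : A.card ≤ 2 * m.card := by
  have hsub : A ⊆ m.biUnion fun e => e.toFinset := by
    intro v hv
    have := hA v hv
    simp only [unmatched, Set.mem_ofPred_eq, not_forall, not_not] at this
    obtain ⟨e, he, hve⟩ := this
    exact Finset.mem_biUnion.2 ⟨e, he, by simpa using hve⟩
  refine (Finset.card_le_card hsub).trans (Finset.card_biUnion_le_card_mul _ _ 2 ?_ |>.trans ?_)
  · intro e _
    induction e with
    | _ a b =>
      rw [Sym2.toFinset_mk_eq]
      exact Finset.card_le_two
  · omega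

theorem exists_inner {I : List V} {v : V} (h : v ∈ I.tail.dropLast) :
    ∃ c w₁ w₂ d, I = c ++ w₁ :: v :: w₂ :: d := by
  match I with
  | [] => simp at h
  | x :: I =>
    rw [List.tail_cons] at h
    rcases List.eq_nil_or_concat I with rfl | ⟨I, y, rfl⟩
    · simp at h
    · rw [List.concat_eq_append, List.dropLast_concat] at h
      obtain ⟨a, b, rfl⟩ := List.append_of_mem h
      rcases List.eq_nil_or_concat a with rfl | ⟨a, z, rfl⟩
      · cases b with
        | nil => exact ⟨[], x, y, [], by simp⟩
        | cons w b => exact ⟨[], x, w, b ++ [y], by simp⟩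
      · cases b with
        | nil => exact ⟨x :: a, z, y, [], by simp⟩
        | cons w b => exact ⟨x :: a, z, w, b ++ [y], by simp⟩

theorem exists_innerPivots [Fintype V] [DecidableEq V] (m : Finset (Sym2 V)) {I : List V}
    (hI : I.Nodup) :
    ∃ P : Finset V, (∀ v ∈ P, v ∈ innerPivots m I) ∧ I.length ≤ P.card + 2 + 2 * m.card := by
  classical
  refine ⟨I.tail.dropLast.toFinset.filter (· ∈ unmatched m), ?_, ?_⟩
  · intro v hv
    rw [Finset.mem_filter, List.mem_toFinset] at hv
    exact ⟨hv.2, exists_inner hv.1⟩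
  · have h1 : I.tail.dropLast.toFinset.card = I.length - 1 - 1 := by
      rw [List.toFinset_card_of_nodup
        (hI.sublist ((List.dropLast_sublist _).trans (List.tail_sublist _)))]
      simp
    have h2 := Finset.card_filter_add_card_filter_not (s := I.tail.dropLast.toFinset)
      (· ∈ unmatched m)
    have h3 := card_matched_le m (I.tail.dropLast.toFinset.filter (· ∉ unmatched m)) (by simp)
    omega

variable [Fintype V] [DecidableEq V] {l : ℕ}

/-- A closed set cannot have size between `l` and `2 * l`. Together with its at most `4 * l`
neighbors along `I` it would miss at least `l` of the more than `7 * l` inner pivots, and an edge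
from `X` to these contradicts closedness. -/
theorem IsRotationClosed.card_lt {I : List V} (hI : I.Nodup)
    (hL : ∀ A B : Finset V, Disjoint A B → l ≤ A.card → l ≤ B.card → ∃ a ∈ A, ∃ b ∈ B, G.Adj a b)
    (hlen : 7 * l + 2 + 2 * m.card < I.length) {X : Finset V} (hX : IsRotationClosed G m I X)
    (hcard : X.card ≤ 2 * l) : X.card < l := by
  classical
  by_contra! hl
  obtain ⟨P, hP, hPc⟩ := exists_innerPivots m hI
  let N := Finset.univ.filter fun v => ∃ w ∈ X, s(v, w) ∈ pathEdges I
  have hN : N.card ≤ 2 * X.card := pathEdges_neighbors_card hI N X (by simp [N])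
  let Z := P \ (X ∪ N)
  have h1 : P.card ≤ Z.card + (X ∪ N).card := by
    rw [← tsub_le_iff_right]
    exact Finset.le_card_sdiff _ _
  have h2 := Finset.card_union_le X N
  obtain ⟨x, hx, v, hv, hadj⟩ := hL X Z
    (Finset.disjoint_of_subset_left Finset.subset_union_left Finset.disjoint_sdiff) hl (by omega)
  rw [Finset.mem_sdiff, Finset.mem_union, not_or] at hv
  rcases hX x hx v (hP v hv.1) hadj with h | h
  · exact hv.2.1 h
  · exact hv.2.2 (by simpa [N] using h)

open Classical in
/-- The vertices from which rotations with pivots inside `I` might reach only few vertices. -/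
noncomputable def badVertices (G : SimpleGraph V) (m : Finset (Sym2 V)) (l : ℕ) (I : List V) :
    Finset V :=
  Finset.univ.filter fun x => ∃ X, IsRotationClosed G m I X ∧ X.card < l ∧ x ∈ X

/-- Closed sets are stable under union. Adding sets of size below `l` one at a time never exceeds `2
* l`, so the size gap of `IsRotationClosed.card_lt` keeps every partial union below `l`. -/
theorem card_badVertices_lt {I : List V} (hl : 0 < l) (hI : I.Nodup)
    (hL : ∀ A B : Finset V, Disjoint A B → l ≤ A.card → l ≤ B.card → ∃ a ∈ A, ∃ b ∈ B, G.Adj a b)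
    (hlen : 7 * l + 2 + 2 * m.card < I.length) : (badVertices G m l I).card < l := by
  have key : ∀ S : Finset V, S ⊆ badVertices G m l I →
      ∃ Y, IsRotationClosed G m I Y ∧ Y.card < l ∧ S ⊆ Y := by
    intro S
    induction S using Finset.induction_on with
    | empty => exact fun _ => ⟨∅, by simp [IsRotationClosed], by simpa, le_rfl⟩
    | insert x S _ ih =>
      intro hS
      rw [Finset.insert_subset_iff] at hS
      obtain ⟨Y, hY, hYc, hSY⟩ := ih hS.2
      obtain ⟨X, hX, hXc, hxX⟩ : ∃ X, IsRotationClosed G m I X ∧ X.card < l ∧ x ∈ X := by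
        simpa [badVertices] using hS.1
      refine ⟨X ∪ Y, hX.union hY, (hX.union hY).card_lt hI hL hlen ?_, ?_⟩
      · exact (Finset.card_union_le _ _).trans (by omega)
      · exact Finset.insert_subset (Finset.mem_union_left _ hxX)
          (hSY.trans Finset.subset_union_right)
  obtain ⟨Y, -, h1, h2⟩ := key _ le_rfl
  exact (Finset.card_le_card h2).trans_lt h1

/-- Rotations with pivots inside an unbroken segment reach many end vertices. -/
theorem exists_many_heads {I q : List V} (hI : I.Nodup) (hq : q.Nodup)
    (hIq : ∀ e ∈ pathEdges I, e ∈ pathEdges q) {a : V} (ha : q.head? = some a)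
    (hbad : a ∉ badVertices G m l I) :
    ∃ X : Finset V, l ≤ X.card ∧
      ∀ x ∈ X, ∃ t q', Reach G (innerPivots m I) t q q' ∧ q'.head? = some x := by
  classical
  let X : Finset V := Finset.univ.filter fun x => ∃ t, x ∈ heads G (innerPivots m I) t q
  have hX : ∀ x, x ∈ X ↔ ∃ t, x ∈ heads G (innerPivots m I) t q := by simp [X]
  refine ⟨X, ?_, fun x hx => ?_⟩
  · by_contra! hlt
    refine hbad ?_
    rw [badVertices, Finset.mem_filter]
    refine ⟨Finset.mem_univ _, X, ?_, hlt, (hX a).2 ⟨0, mem_heads.2 ⟨q, rfl, ha⟩⟩⟩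
    intro x hx v hv hadj
    obtain ⟨t, ht⟩ := (hX x).1 hx
    obtain ⟨c, w₁, w₂, d, rfl⟩ := hv.2
    have hw : w₁ ≠ w₂ := by
      rintro rfl
      simp [List.nodup_append] at hI
    have e₁ : s(w₁, v) ∈ pathEdges (c ++ w₁ :: v :: w₂ :: d) := by
      rw [pathEdges_append]; simp
    have e₂ : s(v, w₂) ∈ pathEdges (c ++ w₁ :: v :: w₂ :: d) := by
      rw [pathEdges_append]; simp
    have hvq : v ∈ q := mem_of_mem_pathEdges (hIq _ e₁) (by simp)
    rcases heads_expand ht hv hvq hadj with h | ⟨w, hw', he⟩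
    · exact Or.inl ((hX v).2 ⟨t, h⟩)
    · refine Or.inr ⟨w, (hX w).2 ⟨t + 1, hw'⟩, ?_⟩
      -- An inner vertex `v` of `I` already has its two neighbors `w₁`, `w₂` on `q`; a third one is
      -- impossible, so `w` is a neighbor along `I` as well.
      have hcard := pathEdges_neighbors_card hq {w, w₁, w₂} {v} (by
        intro u hu
        refine ⟨v, by simp, ?_⟩
        simp only [Finset.mem_insert, Finset.mem_singleton] at hu
        rcases hu with rfl | rfl | rfl
        · rw [Sym2.eq_swap]; exact he
        · exact hIq _ e₁
        · rw [Sym2.eq_swap]; exact hIq _ e₂)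
      by_cases h1 : w = w₁
      · rw [h1, Sym2.eq_swap]; exact e₁
      by_cases h2 : w = w₂
      · rw [h2]; exact e₂
      rw [Finset.card_insert_of_notMem (by simp [h1, h2]), Finset.card_pair hw] at hcard
      simp at hcard
  · obtain ⟨t, ht⟩ := (hX x).1 hx
    exact ⟨t, mem_heads.1 ht⟩

end Segments

/-! ### Separating two unbroken segments by one cut. -/

section Splitting

variable {V : Type*}

/-- A path all of whose edges lie on the path `q ++ r`, except the edge joining `q` to `r`, is
contained in `q` or in `r`. -/
theorem pathEdges_subset_or {q r I : List V} (hqr : (q ++ r).Nodup)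
    (hI : ∀ e ∈ pathEdges I, e ∈ pathEdges (q ++ r))
    (hcut : ∀ e ∈ pathEdges I, ¬ ∃ w ∈ q.getLast?, ∃ v ∈ r.head?, e = s(w, v)) :
    (∀ e ∈ pathEdges I, e ∈ pathEdges q) ∨ (∀ e ∈ pathEdges I, e ∈ pathEdges r) := by
  have hdisj : ∀ v, v ∈ q → v ∉ r := fun v h1 h2 => (List.nodup_append.1 hqr).2.2 v h1 v h2 rfl
  induction I with
  | nil => simp
  | cons x I ih =>
    match I, ih with
    | [], _ => simp
    | y :: I, ih =>
      simp only [pathEdges_cons_cons, List.forall_mem_cons] at hI hcut ⊢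
      have h1 : s(x, y) ∈ pathEdges q ∨ s(x, y) ∈ pathEdges r := by
        rcases mem_pathEdges_append hI.1 with h | h | h
        · exact Or.inl h
        · exact Or.inr h
        · exact absurd h hcut.1
      match I, ih hI.2 hcut.2 with
      | [], _ => simpa using h1
      | z :: I, h2 =>
        have hz : s(y, z) ∈ pathEdges (y :: z :: I) := by simp
        rcases h1 with h1 | h1 <;> rcases h2 with h2 | h2
        · exact Or.inl ⟨h1, h2⟩
        · exact absurd (mem_of_mem_pathEdges (h2 _ hz) (by simp))
            (hdisj y (mem_of_mem_pathEdges h1 (by simp)))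
        · exact absurd (mem_of_mem_pathEdges h1 (by simp))
            (hdisj y (mem_of_mem_pathEdges (h2 _ hz) (by simp)))
        · exact Or.inr ⟨h1, h2⟩

theorem pathEdges_ne_nil {I : List V} (h : 2 ≤ I.length) : ∃ e, e ∈ pathEdges I := by
  match I, h with
  | x :: y :: I, _ => exact ⟨s(x, y), by simp⟩

theorem not_isDiag_of_mem_pathEdges {p : List V} (hp : p.Nodup) {e : Sym2 V}
    (he : e ∈ pathEdges p) : ¬ e.IsDiag := by
  obtain ⟨c, u, v, d, rfl, rfl⟩ := exists_of_mem_pathEdges he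
  rw [Sym2.mk_isDiag_iff]
  rintro rfl
  simp [List.nodup_append] at hp

/-- Among three disjoint unbroken segments of a path, two can be separated by cutting the path. -/
theorem exists_split_of_unbroken {ι : Type*} [DecidableEq ι] {p : List V} (hp : p.Nodup)
    {I : ι → List V} (hlen : ∀ i, 2 ≤ (I i).length)
    (hdisj : ∀ i j, i ≠ j → ∀ v ∈ I i, v ∉ I j) (U : Finset ι) (hU : 3 ≤ U.card)
    (hUp : ∀ i ∈ U, ∀ e ∈ pathEdges (I i), e ∈ pathEdges p) :
    ∃ q r, p = q ++ r ∧ ∃ i j, (∀ e ∈ pathEdges (I i), e ∈ pathEdges q) ∧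
      (∀ e ∈ pathEdges (I j), e ∈ pathEdges r) := by
  classical
  have hsame : ∀ i j e, e ∈ pathEdges (I i) → e ∈ pathEdges (I j) → i = j := by
    intro i j e hi hj
    by_contra hij
    induction e with
    | _ a b =>
      exact hdisj i j hij a (mem_of_mem_pathEdges hi (by simp)) (mem_of_mem_pathEdges hj (by simp))
  let cut : ℕ → ι → Prop := fun k i => ∃ e ∈ pathEdges (I i),
    ∃ w ∈ (p.take k).getLast?, ∃ v ∈ (p.drop k).head?, e = s(w, v)
  have hcut : ∀ k i j, cut k i → cut k j → i = j := by
    rintro k i j ⟨e, he, w, hw, v, hv, rfl⟩ ⟨e', he', w', hw', v', hv', rfl⟩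
    rw [Option.mem_def] at hw hv hw' hv'
    obtain rfl : w = w' := by rw [hw] at hw'; simpa using hw'
    obtain rfl : v = v' := by rw [hv] at hv'; simpa using hv'
    exact hsame _ _ _ he he'
  have htri : ∀ k, ∀ i ∈ U, cut k i ∨ (∀ e ∈ pathEdges (I i), e ∈ pathEdges (p.take k)) ∨
      (∀ e ∈ pathEdges (I i), e ∈ pathEdges (p.drop k)) := by
    intro k i hi
    by_cases hc : cut k i
    · exact Or.inl hc
    · right
      refine pathEdges_subset_or (by rwa [List.take_append_drop])
        (by rw [List.take_append_drop]; exact hUp i hi) fun e he h => hc ⟨e, he, h⟩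
  -- The cut is made at the shortest prefix containing a whole segment `I i₀`. At most one other
  -- segment is cut there, so among three segments some `j ≠ i₀` lies on one side.
  have hex : ∃ k, ∃ i ∈ U, ∀ e ∈ pathEdges (I i), e ∈ pathEdges (p.take k) := by
    obtain ⟨i, hi⟩ := Finset.card_pos.1 (show 0 < U.card by omega)
    exact ⟨p.length, i, hi, by simpa using hUp i hi⟩
  obtain ⟨i₀, hi₀, hin⟩ := Nat.find_spec hex
  have hmin := fun k => Nat.find_min hex (m := k)
  generalize Nat.find hex = k at hin hmin
  cases k with
  | zero =>
    obtain ⟨e, he⟩ := pathEdges_ne_nil (hlen i₀)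
    simpa using hin e he
  | succ k =>
    obtain ⟨j, hj, hji, hjc⟩ : ∃ j ∈ U, j ≠ i₀ ∧ ¬ cut (k + 1) j := by
      by_contra! hcon
      have : (U.erase i₀).card ≤ 1 := by
        rw [Finset.card_le_one]
        intro a ha b hb
        rw [Finset.mem_erase] at ha hb
        exact hcut _ _ _ (hcon a ha.2 ha.1) (hcon b hb.2 hb.1)
      rw [Finset.card_erase_of_mem hi₀] at this
      omega
    rcases htri (k + 1) j hj with h | h | h
    · exact absurd h hjc
    · exfalso
      -- If `j` were in the same prefix, the cut one vertex earlier would go through both segments: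
      -- by minimality neither fits in the shorter prefix, and the single remaining vertex carries
      -- no edge.
      have hk : ∀ i ∈ U, (∀ e ∈ pathEdges (I i), e ∈ pathEdges (p.take (k + 1))) → cut k i := by
        intro i hi hik
        rcases htri k i hi with h | h | h
        · exact h
        · exact absurd ⟨i, hi, h⟩ (hmin k (Nat.lt_succ_self k))
        · exfalso
          obtain ⟨e, he⟩ := pathEdges_ne_nil (hlen i)
          have h1 := hik e he
          have h2 := h e he
          have hmem : ∀ v ∈ e, p[k]? = some v := by
            intro v hv
            have hv1 := mem_of_mem_pathEdges h1 hv
            have hv2 := mem_of_mem_pathEdges h2 hv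
            rw [List.take_add_one, List.mem_append] at hv1
            rcases hv1 with hv1 | hv1
            · exact absurd hv2 (List.disjoint_take_drop hp le_rfl hv1)
            · simpa using hv1
          refine not_isDiag_of_mem_pathEdges (hp.sublist (List.take_sublist _ _)) h1 ?_
          induction e with
          | _ a b =>
            rw [Sym2.mk_isDiag_iff]
            have ha := hmem a (by simp)
            rw [hmem b (by simp)] at ha
            simpa using ha.symm
      exact hji (hcut k _ _ (hk j hj h) (hk i₀ hi₀ hin))
    · exact ⟨p.take (k + 1), p.drop (k + 1), (List.take_append_drop _ _).symm, i₀, j, hin, h⟩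

/-- The segments are disjoint, so each lost edge breaks at most one of them and at least three
survive. -/
theorem exists_split [DecidableEq V] {K t : ℕ} (hK : t + 3 ≤ K) {p : List V} (hp : p.Nodup)
    {I : Fin K → List V} (hlen : ∀ i, 2 ≤ (I i).length)
    (hdisj : ∀ i j, i ≠ j → ∀ v ∈ I i, v ∉ I j) (S : Finset (Sym2 V)) (hS : S.card ≤ t)
    (hSp : ∀ i, ∀ e ∈ pathEdges (I i), e ∉ S → e ∈ pathEdges p) :
    ∃ q r, p = q ++ r ∧ ∃ i j, (∀ e ∈ pathEdges (I i), e ∈ pathEdges q) ∧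
      (∀ e ∈ pathEdges (I j), e ∈ pathEdges r) := by
  classical
  let U : Finset (Fin K) := Finset.univ.filter fun i => ∀ e ∈ pathEdges (I i), e ∉ S
  refine exists_split_of_unbroken hp hlen hdisj U ?_ ?_
  · have h1 := Finset.card_filter_add_card_filter_not (s := (Finset.univ : Finset (Fin K)))
      (fun i => ∀ e ∈ pathEdges (I i), e ∉ S)
    have h2 : (Finset.univ.filter fun i => ¬ ∀ e ∈ pathEdges (I i), e ∉ S).card ≤ S.card := by
      have hch : ∀ i ∈ Finset.univ.filter fun i => ¬ ∀ e ∈ pathEdges (I i), e ∉ S,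
          ∃ e ∈ S, e ∈ pathEdges (I i) := by
        intro i hi
        simp only [Finset.mem_filter, Finset.mem_univ, true_and, not_forall, not_not] at hi
        obtain ⟨e, h1, h2⟩ := hi
        exact ⟨e, h2, h1⟩
      refine Finset.card_le_card_of_forall_subsingleton (fun i e => e ∈ pathEdges (I i)) hch ?_
      rintro e - i ⟨-, hi⟩ j ⟨-, hj⟩
      by_contra hij
      induction e with
      | _ a b =>
        exact hdisj i j hij a (mem_of_mem_pathEdges hi (by simp))
          (mem_of_mem_pathEdges hj (by simp))
    rw [Finset.card_univ, Fintype.card_fin] at h1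
    change 3 ≤ (Finset.univ.filter fun i => ∀ e ∈ pathEdges (I i), e ∉ S).card
    omega
  · intro i hi e he
    exact hSp i e he ((Finset.mem_filter.1 hi).2 e he)

end Splitting

/-! ### A Hamilton cycle through a small matching. -/

section Hamiltonicity

variable {V : Type*} {G : SimpleGraph V} {m : Finset (Sym2 V)}

theorem IsMaxGoodPath.ne_nil [Nonempty V] (hm : PairwiseDisjointEdges m)
    (hmG : ∀ e ∈ m, e ∈ G.edgeSet) {p : List V} (h : IsMaxGoodPath G m p) : p ≠ [] := by
  rintro rfl
  obtain ⟨v⟩ := ‹Nonempty V›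
  by_cases hv : v ∈ unmatched m
  · have hg : IsGoodPath G m [v] := by
      refine ⟨by simp, by simp, fun e he u hu hup => ?_⟩
      rw [List.mem_singleton] at hup
      exact absurd (hup ▸ hu) (hv e he)
    simpa using h.le _ hg
  · simp only [unmatched, Set.mem_ofPred_eq, not_forall, not_not] at hv
    obtain ⟨e, he, hve⟩ := hv
    obtain ⟨w, rfl⟩ := Sym2.mem_iff_exists.1 hve
    have hvw : G.Adj v w := hmG _ he
    have hg : IsGoodPath G m [v, w] := by
      refine ⟨by simp [hvw.ne], by simp [hvw], fun f hf u hu hup => ?_⟩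
      have : u ∈ s(v, w) := by simpa using hup
      rw [hm f hf _ he u hu this]
      simp
    simpa using h.le _ hg

/-- Maximality places all neighbors of a reached end on the path, so every unmatched neighbor is
available as a pivot and the abstract growth hypothesis applies to the sets of ends. -/
theorem IsMaxGoodPath.card_heads_ge [Fintype V] {N T : ℕ} (hm : PairwiseDisjointEdges m)
    (hmG : ∀ e ∈ m, e ∈ G.edgeSet)
    (hexp : ∀ H : ℕ → Finset V, Monotone H → (H 0).Nonempty →
      (∀ t, ∀ A : Finset V, (∀ v ∈ A, v ∈ unmatched m ∧ ∃ y ∈ H t, G.Adj y v) →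
        A.card ≤ 3 * (H (t + 1)).card) → N ≤ (H T).card)
    {p : List V} (h : IsMaxGoodPath G m p) (hp : p ≠ []) :
    N ≤ (heads G (unmatched m) T p).card := by
  refine hexp (fun t => heads G (unmatched m) t p) (heads_mono p) ?_ ?_
  · obtain ⟨x, p', rfl⟩ := List.exists_cons_of_ne_nil hp
    exact ⟨x, mem_heads.2 ⟨_, rfl, rfl⟩⟩
  · intro t A hA
    refine heads_neighbors_card h.good.nodup A fun v hv => ?_
    obtain ⟨h1, y, hy, hadj⟩ := hA v hv
    obtain ⟨p', hr, hy'⟩ := mem_heads.1 hy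
    exact ⟨h1, hr.perm.mem_iff.1 ((h.of_perm hr.perm (h.good.reach le_rfl hr)).neighbor_mem
      hm hmG hy' hadj), y, hy, hadj⟩

/-- The Hamilton cycle containing a small set of disjoint edges of an expanding graph. -/
theorem exists_isHamiltonCycle_containing [Fintype V] [DecidableEq V] [Nonempty V] {l N T : ℕ}
    (hm : PairwiseDisjointEdges m) (hmG : ∀ e ∈ m, e ∈ G.edgeSet)
    (hconn : ∀ A : Set V, A.Nonempty → A ≠ Set.univ → ∃ u ∈ A, ∃ z ∉ A, G.Adj u z)
    (hl : 0 < l)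
    (hL : ∀ A B : Finset V, Disjoint A B → l ≤ A.card → l ≤ B.card → ∃ a ∈ A, ∃ b ∈ B, G.Adj a b)
    (hexp : ∀ H : ℕ → Finset V, Monotone H → (H 0).Nonempty →
      (∀ t, ∀ A : Finset V, (∀ v ∈ A, v ∈ unmatched m ∧ ∃ y ∈ H t, G.Adj y v) →
        A.card ≤ 3 * (H (t + 1)).card) → N ≤ (H T).card)
    (hN : (2 * T + 3) * (7 * l + 2 * m.card + 3) ≤ N) :
    ∃ C : G.Subgraph, IsHamiltonCycle G C ∧ ∀ e ∈ m, e ∈ C.edgeSet := by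
  obtain ⟨p, hp⟩ := exists_isMaxGoodPath G m
  have hpn := hp.ne_nil hm hmG
  have hH := hp.card_heads_ge hm hmG hexp hpn
  have hNp : N ≤ p.length := by
    refine hH.trans ((Finset.card_le_card (t := p.toFinset) fun x hx => ?_).trans
      (List.toFinset_card_le _))
    obtain ⟨p', hr, hx⟩ := mem_heads.1 hx
    exact List.mem_toFinset.2 (hr.perm.mem_iff.1 (List.mem_of_head? hx))
  set L := 7 * l + 2 * m.card + 3 with hLdef
  let I : Fin (2 * T + 3) → List V := fun i => (p.drop (i * L)).take L
  have hIinfix : ∀ i, I i <:+: p := fun i =>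
    (List.take_prefix _ _).isInfix.trans (List.drop_suffix _ _).isInfix
  have hInd : ∀ i, (I i).Nodup := fun i => hp.good.nodup.sublist (hIinfix i).sublist
  have hIlen : ∀ i, (I i).length = L := by
    intro i
    have h1 : (i + 1) * L ≤ (2 * T + 3) * L := Nat.mul_le_mul_right L (by omega)
    have h2 : (i + 1) * L = i * L + L := by ring
    simp only [I, List.length_take, List.length_drop]
    omega
  have hIdisj' : ∀ i j : Fin (2 * T + 3), i < j → ∀ v ∈ I i, v ∉ I j := by
    intro i j hij v hvi hvj
    have h1 : (i + 1) * L ≤ j * L := Nat.mul_le_mul_right L hij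
    have h2 : (i + 1) * L = i * L + L := by ring
    have h3 : v ∈ p.take (i * L + L) := by
      simp only [I, List.take_drop] at hvi
      exact List.mem_of_mem_drop hvi
    exact List.disjoint_take_drop hp.good.nodup (h2.symm.trans_le h1) h3 (List.mem_of_mem_take hvj)
  have hIdisj : ∀ i j, i ≠ j → ∀ v ∈ I i, v ∉ I j := by
    intro i j hij v hvi hvj
    rcases lt_or_gt_of_ne hij with h | h
    · exact hIdisj' i j h v hvi hvj
    · exact hIdisj' j i h v hvj hvi
  -- Ends to avoid. They depend only on the segments of the initial path, so the same set serves for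
  -- both ends, before it is known which segments survive.
  let B := Finset.univ.biUnion fun i => badVertices G m l (I i)
  have hB : B.card < N := by
    have h1 : B.card ≤ (Finset.univ : Finset (Fin (2 * T + 3))).card * l :=
      Finset.card_biUnion_le_card_mul _ _ _ fun i _ =>
        (card_badVertices_lt hl (hInd i) hL (by rw [hIlen]; omega)).le
    rw [Finset.card_univ, Fintype.card_fin] at h1
    have h2 : (2 * T + 3) * l < (2 * T + 3) * L := Nat.mul_lt_mul_of_pos_left (by omega) (by omega)
    omega
  have hBad : ∀ a, a ∉ B → ∀ i, a ∉ badVertices G m l (I i) := fun a ha i hi =>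
    ha (Finset.mem_biUnion.2 ⟨i, Finset.mem_univ i, hi⟩)
  obtain ⟨b, hb, hbB⟩ := Finset.exists_mem_notMem_of_card_lt_card (hB.trans_le hH)
  obtain ⟨p₁, hr₁, hb⟩ := mem_heads.1 hb
  have hp₁ := hp.of_perm hr₁.perm (hp.good.reach le_rfl hr₁)
  have hp₂ := hp₁.of_perm (List.reverse_perm p₁) hp₁.good.reverse
  have hH₂ := hp₂.card_heads_ge hm hmG hexp (by rintro h; simp at h; simp [h] at hb)
  obtain ⟨a, ha, haB⟩ := Finset.exists_mem_notMem_of_card_lt_card (hB.trans_le hH₂)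
  obtain ⟨p₃, hr₃, ha⟩ := mem_heads.1 ha
  have hp₃ := hp₂.of_perm hr₃.perm (hp₂.good.reach le_rfl hr₃)
  have hlast : p₃.getLast? = some b := by
    rw [hr₃.getLast?, List.getLast?_reverse, hb]
  obtain ⟨S₁, hS₁, hlost₁⟩ := hr₁.lost_edges
  obtain ⟨S₂, hS₂, hlost₂⟩ := hr₃.lost_edges
  -- `T` rotations at each end lose at most `2 * T` edges, which is why `2 * T + 3` segments were
  -- prepared.
  obtain ⟨q, r, rfl, i, j, hi, hj⟩ := exists_split (t := 2 * T) le_rfl hp₃.good.nodup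
    (fun i => by rw [hIlen]; omega) hIdisj (S₁ ∪ S₂)
    ((Finset.card_union_le _ _).trans (by omega)) (by
      intro i e he heS
      rw [Finset.mem_union, not_or] at heS
      exact hlost₂ e (mem_pathEdges_reverse.2
        (hlost₁ e (pathEdges_infix (hIinfix i) e he) heS.1)) heS.2)
  have hqr := List.nodup_append.1 hp₃.good.nodup
  have hne : ∀ i (q : List V), (∀ e ∈ pathEdges (I i), e ∈ pathEdges q) → q ≠ [] := by
    rintro i q h rfl
    obtain ⟨e, he⟩ := pathEdges_ne_nil (I := I i) (by rw [hIlen]; omega)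
    simpa using h e he
  rw [List.head?_append_of_ne_nil _ (hne i q hi)] at ha
  rw [List.getLast?_append_of_ne_nil _ (hne j r hj)] at hlast
  have hpiv : ∀ i, innerPivots m (I i) ⊆ unmatched m := fun i v hv => hv.1
  obtain ⟨X, hXc, hX⟩ := exists_many_heads (hInd i) hqr.1 hi ha (hBad a haB i)
  obtain ⟨Y, hYc, hY⟩ := exists_many_heads (q := r.reverse) (hInd j)
    (List.nodup_reverse.2 hqr.2.1) (fun e he => mem_pathEdges_reverse.2 (hj e he))
    (by rw [List.head?_reverse]; exact hlast) (hBad b hbB j)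
  have hXY : Disjoint X Y := by
    rw [Finset.disjoint_left]
    intro x hx hy
    obtain ⟨t, q', h1, h2⟩ := hX x hx
    obtain ⟨t', r', h3, h4⟩ := hY x hy
    exact hqr.2.2 x (h1.perm.mem_iff.1 (List.mem_of_head? h2)) x
      (List.mem_reverse.1 (h3.perm.mem_iff.1 (List.mem_of_head? h4))) rfl
  obtain ⟨x, hx, y, hy, hadj⟩ := hL X Y hXY hXc hYc
  obtain ⟨t, q', h1, h2⟩ := hX x hx
  obtain ⟨t', r', h3, h4⟩ := hY y hy
  -- The halves are still joined at the cut, and the outer ends are now the adjacent vertices `y`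
  -- and `x`.
  have hg : IsGoodPath G m (r' ++ q'.reverse) := by
    refine IsGoodPath.reach_append (hpiv j) ?_ h3
    have := (hp₃.good.reach_append (hpiv i) h1).reverse
    rwa [List.reverse_append] at this
  have hperm : (r' ++ q'.reverse).Perm (q ++ r) :=
    ((h3.perm.trans (List.reverse_perm r)).append
      ((List.reverse_perm q').trans h1.perm)).trans List.perm_append_comm
  have hmax := hp₃.of_perm hperm hg
  refine hmax.exists_isHamiltonCycle hm hmG hconn ?_ (x := y) (y := x) ?_ ?_ hadj
  · have : p.length ≤ (r' ++ q'.reverse).length := hmax.le _ hp.good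
    have h3L : 1 * 3 ≤ (2 * T + 3) * L := Nat.mul_le_mul (by omega) (by omega)
    omega
  · rw [List.head?_append_of_ne_nil _ (by rintro rfl; simp at h4), h4]
  · rw [List.getLast?_append_of_ne_nil _ (by intro h; simp at h; simp [h] at h2),
      List.getLast?_reverse, h2]

end Hamiltonicity


/-! ### Greedy decomposition into matchings. -/

section EdgeColouring

variable {V : Type*} [DecidableEq V]

/-- A greedy proper edge colouring with `2 * D` colours. -/
theorem exists_edgeColouring (E : Finset (Sym2 V)) (D : ℕ)
    (hD : ∀ v, (E.filter fun e => v ∈ e).card ≤ D) :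
    ∃ c : Sym2 V → ℕ, (∀ e ∈ E, c e < 2 * D) ∧
      ∀ e ∈ E, ∀ f ∈ E, c e = c f → ∀ v, v ∈ e → v ∈ f → e = f := by
  induction E using Finset.induction_on with
  | empty => exact ⟨fun _ => 0, by simp, by simp⟩
  | insert e₀ E he₀ ih =>
    have hsub : ∀ v, (E.filter fun e => v ∈ e).card ≤ ((insert e₀ E).filter fun e => v ∈ e).card :=
      fun v => Finset.card_le_card (Finset.filter_subset_filter _ (Finset.subset_insert _ _))
    obtain ⟨c, hc1, hc2⟩ := ih fun v => (hsub v).trans (hD v)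
    have hlt : ∀ v ∈ e₀, (E.filter fun e => v ∈ e).card < D := by
      intro v hv
      refine lt_of_lt_of_le (Finset.card_lt_card ?_) (hD v)
      rw [Finset.filter_insert, if_pos hv]
      exact Finset.ssubset_insert (by simp [he₀])
    -- The new edge meets fewer than `D` old edges at each end, so some of the `2 * D` colours is
    -- free.
    obtain ⟨k, hk, hkc⟩ : ∃ k < 2 * D, ∀ f ∈ E, ∀ v ∈ e₀, v ∈ f → c f ≠ k := by
      classical
      let W := (E.filter fun f => ∃ v ∈ e₀, v ∈ f).image c
      have hW : W.card < (Finset.range (2 * D)).card := by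
        refine Finset.card_image_le.trans_lt ?_
        rw [Finset.card_range]
        induction e₀ with
        | _ a b =>
          have h1 := hlt a (by simp)
          have h2 := hlt b (by simp)
          have h3 : (E.filter fun f => ∃ v ∈ s(a, b), v ∈ f) ⊆
              (E.filter fun e => a ∈ e) ∪ (E.filter fun e => b ∈ e) := by
            intro f hf
            simp only [Finset.mem_filter, Sym2.mem_iff, Finset.mem_union] at hf ⊢
            obtain ⟨hf, v, rfl | rfl, hv⟩ := hf <;> simp [hf, hv]
          have h4 := (Finset.card_le_card h3).trans (Finset.card_union_le _ _)
          omega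
      obtain ⟨k, hk, hkW⟩ := Finset.exists_mem_notMem_of_card_lt_card hW
      refine ⟨k, Finset.mem_range.1 hk, fun f hf v hv hvf hck => hkW ?_⟩
      exact Finset.mem_image.2 ⟨f, Finset.mem_filter.2 ⟨hf, v, hv, hvf⟩, hck⟩
    have hne : ∀ f ∈ E, f ≠ e₀ := fun f hf h => he₀ (h ▸ hf)
    refine ⟨Function.update c e₀ k, ?_, ?_⟩
    · intro e he
      rcases Finset.mem_insert.1 he with rfl | he
      · simpa using hk
      · rw [Function.update_of_ne (hne e he)]
        exact hc1 e he
    · intro e he f hf hef v hve hvf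
      rcases Finset.mem_insert.1 he with rfl | he' <;> rcases Finset.mem_insert.1 hf with h | hf'
      · exact h.symm
      · rw [Function.update_self, Function.update_of_ne (hne f hf')] at hef
        exact absurd hef.symm (hkc f hf' v hve hvf)
      · subst h
        rw [Function.update_self, Function.update_of_ne (hne e he')] at hef
        exact absurd hef (hkc e he' v hvf hve)
      · rw [Function.update_of_ne (hne e he'), Function.update_of_ne (hne f hf')] at hef
        exact hc2 e he' f hf' hef v hve hvf

end EdgeColouring

/-! ### Degrees left over by a Hamilton packing. -/

section Packing

variable {V : Type*} [Fintype V] [DecidableEq V] {G : SimpleGraph V} [DecidableRel G.Adj]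

open Classical in
theorem IsHamiltonCycle.two_le_card {C : G.Subgraph} (hC : IsHamiltonCycle G C) (v : V) :
    2 ≤ ((G.incidenceFinset v).filter fun e => e ∈ C.edgeSet).card := by
  obtain ⟨u, p, hp, rfl⟩ := hC
  have h2 := hp.isCycle.ncard_neighborSet_toSubgraph_eq_two (hp.mem_support v)
  rw [Set.ncard_eq_toFinset_card'] at h2
  rw [← h2]
  refine Finset.card_le_card_of_injOn (fun w => s(v, w)) ?_ ?_
  · intro w hw
    have hw : p.toSubgraph.Adj v w := by simpa using hw
    simp only [Finset.coe_filter, Set.mem_ofPred_eq, SimpleGraph.mem_incidenceFinset,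
      SimpleGraph.mk'_mem_incidenceSet_iff, SimpleGraph.Subgraph.mem_edgeSet]
    exact ⟨⟨hw.adj_sub, by simp⟩, hw⟩
  · intro w _ w' _ h
    exact Sym2.congr_right.1 h

open Classical in
/-- The edges left uncovered by a Hamilton packing form a graph of small degree. -/
theorem IsHamiltonPacking.card_uncovered_le {P : Finset G.Subgraph} (hP : IsHamiltonPacking G P)
    (v : V) :
    (((G.edgeFinset.filter fun e => ∀ C ∈ P, e ∉ C.edgeSet)).filter fun e => v ∈ e).card +
      2 * P.card ≤ G.maxDegree := by
  have h1 : P.card * 2 ≤ (P.biUnion fun C =>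
      (G.incidenceFinset v).filter fun e => e ∈ C.edgeSet).card := by
    rw [Finset.card_biUnion]
    · rw [← smul_eq_mul]
      exact Finset.card_nsmul_le_sum _ _ _ fun C hC => (hP.1 C hC).two_le_card v
    · intro C hC D hD hCD
      rw [Function.onFun, Finset.disjoint_left]
      intro e he he'
      rw [Finset.mem_filter] at he he'
      refine hCD (hP.2 e ?_ C hC D hD he.2 he'.2)
      exact C.edgeSet_subset he.2
  have h2 : Disjoint
      (((G.edgeFinset.filter fun e => ∀ C ∈ P, e ∉ C.edgeSet)).filter fun e => v ∈ e)
      (P.biUnion fun C => (G.incidenceFinset v).filter fun e => e ∈ C.edgeSet) := by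
    rw [Finset.disjoint_left]
    intro e he he'
    simp only [Finset.mem_filter, Finset.mem_biUnion] at he he'
    obtain ⟨C, hC, -, h⟩ := he'
    exact he.1.2 C hC h
  have h3 := Finset.card_le_card (s :=
      (((G.edgeFinset.filter fun e => ∀ C ∈ P, e ∉ C.edgeSet)).filter fun e => v ∈ e) ∪
      (P.biUnion fun C => (G.incidenceFinset v).filter fun e => e ∈ C.edgeSet))
      (t := G.incidenceFinset v) (by
    refine Finset.union_subset ?_ (Finset.biUnion_subset.2 fun C _ => Finset.filter_subset _ _)
    intro e he
    simp only [Finset.mem_filter, SimpleGraph.mem_edgeFinset] at he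
    rw [SimpleGraph.mem_incidenceFinset]
    exact ⟨he.1.1, he.2⟩)
  rw [Finset.card_union_of_disjoint h2, SimpleGraph.card_incidenceFinset_eq_degree] at h3
  have h4 := G.degree_le_maxDegree v
  omega

end Packing

/-! ### Splitting a matching by size and by a union bound. -/

section RandomSplitting

variable {V : Type*} [Fintype V]

theorem PairwiseDisjointEdges.card_le {m : Finset (Sym2 V)} (hm : PairwiseDisjointEdges m) :
    m.card ≤ Fintype.card V := by
  rw [← Finset.card_univ]
  refine Finset.card_le_card_of_injOn (fun e => (Quot.out e).1) (by simp) ?_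
  intro e he f hf hef
  refine hm e he f hf _ (Sym2.out_fst_mem e) ?_
  have : (Quot.out e).1 = (Quot.out f).1 := hef
  rw [this]
  exact Sym2.out_fst_mem f

/-- A set can be cut into pieces of bounded size. -/
theorem exists_bounded_pieces {ι : Type*} (m : Finset ι) (k b : ℕ) (hk : 0 < k)
    (h : m.card ≤ k * b) :
    ∃ c : ι → Fin k, ∀ j, (m.filter fun e => c e = j).card ≤ b := by
  classical
  let σ : ι → ℕ := fun e => if he : e ∈ m then m.equivFin ⟨e, he⟩ else 0
  have hσ : ∀ e ∈ m, σ e < k * b := by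
    intro e he
    simp only [σ, dif_pos he]
    exact (Fin.is_lt _).trans_le h
  have hinj : ∀ e ∈ m, ∀ f ∈ m, σ e = σ f → e = f := by
    intro e he f hf hef
    simp only [σ, dif_pos he, dif_pos hf] at hef
    simpa using m.equivFin.injective (Fin.ext hef)
  -- Blocks of `b` consecutive indices. Reduction modulo `k` changes nothing on `m`; it only yields
  -- a value in `Fin k` for the other elements.
  refine ⟨fun e => ⟨σ e / b % k, Nat.mod_lt _ hk⟩, fun j => ?_⟩
  refine (Finset.card_le_card_of_injOn (t := Finset.range b) (fun e => σ e % b) ?_ ?_).trans_eq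
    (Finset.card_range b)
  · intro e he
    have he := (Finset.mem_filter.1 he).1
    have hb : 0 < b := Nat.pos_of_mul_pos_left (Nat.zero_lt_of_lt (hσ e he))
    simpa using Nat.mod_lt _ hb
  · intro e he f hf hef
    have hef : σ e % b = σ f % b := hef
    obtain ⟨he, hej⟩ := Finset.mem_filter.1 he
    obtain ⟨hf, hfj⟩ := Finset.mem_filter.1 hf
    refine hinj e he f hf ?_
    have h1 := Fin.ext_iff.1 (hej.trans hfj.symm)
    simp only at h1
    rw [Nat.mod_eq_of_lt (Nat.div_lt_of_lt_mul ((hσ e he).trans_eq (mul_comm _ _))),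
      Nat.mod_eq_of_lt (Nat.div_lt_of_lt_mul ((hσ f hf).trans_eq (mul_comm _ _)))] at h1
    rw [← Nat.div_add_mod (σ e) b, ← Nat.div_add_mod (σ f) b, h1, hef]

variable [DecidableEq V]

-- At least `T.card / 2` edges of `m` meet `T`, and the colour of each is forced. Since `81 = 3 ^
-- 4`, every vertex of `T` contributes a factor `3 ^ 2`, enough to beat the later choice of `T`
-- among the subsets of a neighborhood.
open Classical in
theorem card_forcedColourings_le {m : Finset (Sym2 V)} (hm : PairwiseDisjointEdges m)
    (T : Finset V) (i : Fin 81) :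
    ((Finset.univ.filter fun f : Sym2 V → Fin 81 =>
      ∀ v ∈ T, ∃ e ∈ m, v ∈ e ∧ f e = i).card) * 3 ^ (2 * T.card) ≤
        81 ^ Fintype.card (Sym2 V) := by
  by_cases hT : ∀ v ∈ T, ∃ e ∈ m, v ∈ e
  · let E := m.filter fun e => ∃ v ∈ T, v ∈ e
    have hE : T.card ≤ 2 * E.card := by
      refine card_matched_le E T fun v hv hvE => ?_
      obtain ⟨e, he, hve⟩ := hT v hv
      exact hvE e (Finset.mem_filter.2 ⟨he, v, hv, hve⟩) hve
    have hsub : (Finset.univ.filter fun f : Sym2 V → Fin 81 =>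
        ∀ v ∈ T, ∃ e ∈ m, v ∈ e ∧ f e = i) ⊆
        Fintype.piFinset fun e => if e ∈ E then {i} else Finset.univ := by
      intro f hf
      rw [Fintype.mem_piFinset]
      intro e
      split_ifs with heE
      · obtain ⟨he, v, hv, hve⟩ := Finset.mem_filter.1 heE
        obtain ⟨e', he', hve', hfe'⟩ := (Finset.mem_filter.1 hf).2 v hv
        rw [hm e he e' he' v hve hve', hfe', Finset.mem_singleton]
      · exact Finset.mem_univ _
    have hcard : (Fintype.piFinset fun e : Sym2 V =>
        if e ∈ E then ({i} : Finset (Fin 81)) else Finset.univ).card * 81 ^ E.card =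
        81 ^ Fintype.card (Sym2 V) := by
      rw [Fintype.card_piFinset]
      have : ∀ e : Sym2 V, (if e ∈ E then ({i} : Finset (Fin 81)) else Finset.univ).card =
          if e ∈ E then 1 else 81 := by
        intro e
        split_ifs <;> simp
      simp only [this]
      rw [Finset.prod_ite]
      simp only [Finset.prod_const_one, one_mul, Finset.prod_const]
      rw [← pow_add, ← Finset.card_univ]
      congr 1
      have := Finset.card_filter_add_card_filter_not (s := (Finset.univ : Finset (Sym2 V)))
        (· ∈ E)
      simp only [Finset.filter_univ_mem] at this
      omega
    rw [← hcard]
    refine Nat.mul_le_mul (Finset.card_le_card hsub) ?_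
    rw [show 81 = 3 ^ 4 by norm_num, ← pow_mul]
    exact Nat.pow_le_pow_right (by norm_num) (by omega)
  · have : (Finset.univ.filter fun f : Sym2 V → Fin 81 =>
        ∀ v ∈ T, ∃ e ∈ m, v ∈ e ∧ f e = i) = ∅ := by
      rw [Finset.filter_eq_empty_iff]
      intro f _ hf
      refine hT fun v hv => ?_
      obtain ⟨e, he, hve, -⟩ := hf v hv
      exact ⟨e, he, hve⟩
    rw [this]
    simp

/-- A matching can be coloured such that no colour class meets most of the neighborhood of a
set from an expanding family. -/
theorem exists_splitting_colouring (G : SimpleGraph V) {m : Finset (Sym2 V)}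
    (hm : PairwiseDisjointEdges m) (𝒜 : Finset V → Prop) (d : ℕ)
    (hexp : ∀ A, 𝒜 A → d * A.card ≤ (extNeighbors G A).card)
    (hd : 81 * (1 + (2 / 3 : ℝ) ^ d) ^ Fintype.card V < 82) :
    ∃ f : Sym2 V → Fin 81, ∀ A, 𝒜 A → ∀ i, ∃ N : Finset V, N ⊆ extNeighbors G A ∧
      (extNeighbors G A).card ≤ 2 * N.card ∧
      ∀ v ∈ N, v ∈ unmatched (m.filter fun e => f e = i) := by
  classical
  by_contra! hcon
  let M := Fintype.card (Sym2 V)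
  let F : Finset V → Fin 81 → Finset (Sym2 V → Fin 81) := fun T i =>
    Finset.univ.filter fun f => ∀ v ∈ T, ∃ e ∈ m, v ∈ e ∧ f e = i
  let 𝒮 : Finset (Finset V) := (Finset.univ.powerset.erase ∅).filter 𝒜
  let 𝒯 : Finset V → Finset (Finset V) := fun A =>
    (extNeighbors G A).powerset.filter fun T => (extNeighbors G A).card ≤ 2 * T.card
  have hcover : (Finset.univ : Finset (Sym2 V → Fin 81)) ⊆
      𝒮.biUnion fun A => Finset.univ.biUnion fun i => (𝒯 A).biUnion fun T => F T i := by
    intro f _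
    obtain ⟨A, hA, i, hi⟩ := hcon f
    let U := unmatched (m.filter fun e => f e = i)
    have h1 := Finset.card_filter_add_card_filter_not (s := extNeighbors G A) (· ∈ U)
    have h2 : 2 * ((extNeighbors G A).filter (· ∈ U)).card < (extNeighbors G A).card := by
      by_contra! hlt
      obtain ⟨v, hv, hvU⟩ := hi _ (Finset.filter_subset _ _) hlt
      exact hvU (Finset.mem_filter.1 hv).2
    simp only [Finset.mem_biUnion]
    -- The witness `T` is the set of neighbors matched in colour `i`, more than half of the
    -- neighborhood.
    refine ⟨A, ?_, i, Finset.mem_univ i, (extNeighbors G A).filter (· ∉ U), ?_, ?_⟩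
    · refine Finset.mem_filter.2 ⟨Finset.mem_erase.2 ⟨?_, by simp⟩, hA⟩
      rintro rfl
      simp [extNeighbors] at h2
    · exact Finset.mem_filter.2 ⟨Finset.mem_powerset.2 (Finset.filter_subset _ _), by omega⟩
    · refine Finset.mem_filter.2 ⟨Finset.mem_univ f, fun v hv => ?_⟩
      have hvU := (Finset.mem_filter.1 hv).2
      simp only [U, unmatched, Set.mem_ofPred_eq, not_forall, not_not] at hvU
      obtain ⟨e, he, hve⟩ := hvU
      obtain ⟨he, hfe⟩ := Finset.mem_filter.1 he
      exact ⟨e, he, hve, hfe⟩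
  have hF : ∀ A, ∀ i, ∀ T ∈ 𝒯 A,
      ((F T i).card : ℝ) ≤ 81 ^ M / 3 ^ (extNeighbors G A).card := by
    intro A i T hT
    rw [le_div_iff₀ (by positivity)]
    have h1 : (F T i).card * 3 ^ (extNeighbors G A).card ≤ 81 ^ M :=
      (Nat.mul_le_mul le_rfl (Nat.pow_le_pow_right (by norm_num)
        (Finset.mem_filter.1 hT).2)).trans (card_forcedColourings_le hm T i)
    exact_mod_cast h1
  have hA : ∀ A ∈ 𝒮, ∑ i : Fin 81, ∑ T ∈ 𝒯 A, ((F T i).card : ℝ) ≤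
      81 ^ M * 81 * ((2 / 3 : ℝ) ^ d) ^ A.card := by
    intro A hA
    have h1 : ∀ i ∈ (Finset.univ : Finset (Fin 81)), ∑ T ∈ 𝒯 A, ((F T i).card : ℝ) ≤
        2 ^ (extNeighbors G A).card * (81 ^ M / 3 ^ (extNeighbors G A).card) := by
      intro i _
      refine (Finset.sum_le_card_nsmul _ _ _ (hF A i)).trans ?_
      rw [nsmul_eq_mul]
      refine mul_le_mul_of_nonneg_right ?_ (by positivity)
      have : (𝒯 A).card ≤ 2 ^ (extNeighbors G A).card := by
        rw [← Finset.card_powerset]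
        exact Finset.card_filter_le _ _
      exact_mod_cast this
    refine (Finset.sum_le_card_nsmul _ _ _ h1).trans ?_
    rw [Finset.card_univ, Fintype.card_fin, nsmul_eq_mul]
    have h2 : (2 / 3 : ℝ) ^ (extNeighbors G A).card ≤ ((2 / 3 : ℝ) ^ d) ^ A.card := by
      rw [← pow_mul]
      exact pow_le_pow_of_le_one (by norm_num) (by norm_num)
        (hexp A (Finset.mem_filter.1 hA).2)
    have h3 : (0 : ℝ) < 81 ^ M := by positivity
    calc ((81 : ℕ) : ℝ) * (2 ^ (extNeighbors G A).card * (81 ^ M / 3 ^ (extNeighbors G A).card))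
        = 81 ^ M * 81 * (2 / 3 : ℝ) ^ (extNeighbors G A).card := by
          rw [div_pow]; push_cast; ring
      _ ≤ _ := by gcongr
  -- For each `A` and colour, the at most `2 ^ |N(A)|` choices of `T` each have probability at most
  -- `3 ^ (-|N(A)|)`. Summing `(2/3) ^ (d * |A|)` over nonempty sets is a binomial expansion without
  -- its constant term.
  have hsum : ∑ A ∈ 𝒮, ((2 / 3 : ℝ) ^ d) ^ A.card ≤
      (1 + (2 / 3 : ℝ) ^ d) ^ Fintype.card V - 1 := by
    have h1 : ∑ A ∈ 𝒮, ((2 / 3 : ℝ) ^ d) ^ A.card ≤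
        ∑ A ∈ (Finset.univ : Finset V).powerset.erase ∅, ((2 / 3 : ℝ) ^ d) ^ A.card :=
      Finset.sum_le_sum_of_subset_of_nonneg (Finset.filter_subset _ _) fun _ _ _ => by positivity
    have h2 := Finset.sum_pow_mul_eq_add_pow ((2 / 3 : ℝ) ^ d) 1 (Finset.univ : Finset V)
    have h3 := Finset.add_sum_erase (Finset.univ : Finset V).powerset
      (fun A => ((2 / 3 : ℝ) ^ d) ^ A.card) (Finset.empty_mem_powerset _)
    simp only [one_pow, mul_one] at h2
    rw [h2, Finset.card_empty, pow_zero, Finset.card_univ, add_comm (_ ^ d)] at h3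
    linarith
  have htotal : (81 : ℝ) ^ M ≤ ∑ A ∈ 𝒮, ∑ i : Fin 81, ∑ T ∈ 𝒯 A, ((F T i).card : ℝ) := by
    have h1 := Finset.card_le_card hcover
    rw [Finset.card_univ, Fintype.card_fun, Fintype.card_fin] at h1
    have h2 : 81 ^ M ≤ ∑ A ∈ 𝒮, ∑ i : Fin 81, ∑ T ∈ 𝒯 A, (F T i).card :=
      h1.trans (Finset.card_biUnion_le.trans (Finset.sum_le_sum fun A _ =>
        Finset.card_biUnion_le.trans (Finset.sum_le_sum fun i _ => Finset.card_biUnion_le)))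
    exact_mod_cast h2
  have hfin := htotal.trans (Finset.sum_le_sum hA)
  rw [← Finset.mul_sum] at hfin
  have hpos : (0 : ℝ) < 81 ^ M := by positivity
  have h5 : (81 : ℝ) ^ M * 81 * ∑ A ∈ 𝒮, ((2 / 3 : ℝ) ^ d) ^ A.card < 81 ^ M * 1 := by
    rw [mul_assoc]
    refine mul_lt_mul_of_pos_left ?_ hpos
    linarith
  linarith

end RandomSplitting


/-! ### Asymptotic estimates for large `n`. -/

section Numerics

open Filter Topology

/-- The number `n` is large enough in terms of `α`. -/
structure LargeEnough (α : ℝ) (n : ℕ) : Prop where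
  linear : 60000 ≤ α * n
  six_le : 6 ≤ (n : ℝ) ^ (α / 2)
  rpow_le : (n : ℝ) ^ α ≤ 4 * α * n
  colours : 81 * (1 + (2 / 3 : ℝ) ^ ⌊(n : ℝ) ^ α⌋₊) ^ n < 82

theorem eventually_rpow_le {α : ℝ} (hα : 0 < α) (hα1 : α ≤ 1) :
    ∀ᶠ n : ℕ in atTop, (n : ℝ) ^ α ≤ 4 * α * n := by
  -- For `α` near 1 the factor `4 * α` is already at least 1; for small `α` the spare power `n ^
  -- (3/4)` absorbs the constant `1 / (4 * α)`.
  by_cases h : 1 / 4 ≤ α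
  · filter_upwards [eventually_ge_atTop 1] with n hn
    have hn : (1 : ℝ) ≤ n := by exact_mod_cast hn
    calc (n : ℝ) ^ α ≤ (n : ℝ) ^ (1 : ℝ) := Real.rpow_le_rpow_of_exponent_le hn hα1
      _ = n := Real.rpow_one _
      _ ≤ 4 * α * n := by nlinarith
  · push Not at h
    have h1 : Tendsto (fun n : ℕ => (n : ℝ) ^ (3 / 4 : ℝ)) atTop atTop :=
      (tendsto_rpow_atTop (by norm_num)).comp tendsto_natCast_atTop_atTop
    filter_upwards [eventually_ge_atTop 1, h1.eventually_ge_atTop (1 / (4 * α))] with n hn h2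
    have hn : (1 : ℝ) ≤ n := by exact_mod_cast hn
    rw [div_le_iff₀ (by positivity)] at h2
    have h3 : (n : ℝ) = (n : ℝ) ^ (1 / 4 : ℝ) * (n : ℝ) ^ (3 / 4 : ℝ) := by
      rw [← Real.rpow_add (by linarith)]
      norm_num
    have h4 : (0 : ℝ) < (n : ℝ) ^ (1 / 4 : ℝ) := by positivity
    calc (n : ℝ) ^ α ≤ (n : ℝ) ^ (1 / 4 : ℝ) := Real.rpow_le_rpow_of_exponent_le hn h.le
      _ ≤ (n : ℝ) ^ (1 / 4 : ℝ) * ((n : ℝ) ^ (3 / 4 : ℝ) * (4 * α)) := by nlinarith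
      _ = 4 * α * ((n : ℝ) ^ (1 / 4 : ℝ) * (n : ℝ) ^ (3 / 4 : ℝ)) := by ring
      _ = 4 * α * n := by rw [← h3]

theorem tendsto_mul_pow_floor_rpow {α : ℝ} (hα : 0 < α) :
    Tendsto (fun n : ℕ => (n : ℝ) * (2 / 3 : ℝ) ^ ⌊(n : ℝ) ^ α⌋₊) atTop (𝓝 0) := by
  have hlog : 0 < Real.log (3 / 2) := Real.log_pos (by norm_num)
  have h1 := tendsto_rpow_mul_exp_neg_mul_atTop_nhds_zero (1 / α) (Real.log (3 / 2)) hlog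
  have h2 : Tendsto (fun n : ℕ => (n : ℝ) ^ α) atTop atTop :=
    (tendsto_rpow_atTop hα).comp tendsto_natCast_atTop_atTop
  have h3 := (h1.comp h2).const_mul (3 / 2)
  rw [mul_zero] at h3
  refine squeeze_zero (fun n => by positivity) (fun n => ?_) h3
  have hn : (0 : ℝ) ≤ n := Nat.cast_nonneg n
  have e1 : ((n : ℝ) ^ α) ^ (1 / α) = n := by
    rw [← Real.rpow_mul hn, mul_one_div_cancel hα.ne', Real.rpow_one]
  -- The factor `3 / 2` pays for rounding the exponent down.
  have e2 : (2 / 3 : ℝ) ^ ⌊(n : ℝ) ^ α⌋₊ ≤ 3 / 2 * Real.exp (-Real.log (3 / 2) * (n : ℝ) ^ α) := by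
    have e3 : (2 / 3 : ℝ) = Real.exp (-Real.log (3 / 2)) := by
      rw [Real.exp_neg, Real.exp_log (by norm_num)]; norm_num
    have e4 : (3 / 2 : ℝ) = Real.exp (Real.log (3 / 2)) := (Real.exp_log (by norm_num)).symm
    have e5 := Nat.lt_floor_add_one ((n : ℝ) ^ α)
    calc (2 / 3 : ℝ) ^ ⌊(n : ℝ) ^ α⌋₊ = Real.exp (⌊(n : ℝ) ^ α⌋₊ * (-Real.log (3 / 2))) := by
          rw [Real.exp_nat_mul, ← e3]
      _ ≤ Real.exp (Real.log (3 / 2) + -Real.log (3 / 2) * (n : ℝ) ^ α) := by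
          rw [Real.exp_le_exp]; nlinarith
      _ = _ := by rw [Real.exp_add, ← e4]
  simp only [Function.comp_apply, e1]
  calc (n : ℝ) * (2 / 3 : ℝ) ^ ⌊(n : ℝ) ^ α⌋₊
      ≤ n * (3 / 2 * Real.exp (-Real.log (3 / 2) * (n : ℝ) ^ α)) :=
        mul_le_mul_of_nonneg_left e2 hn
    _ = _ := by ring

theorem eventually_largeEnough {α : ℝ} (hα : 0 < α) (hα1 : α ≤ 1) :
    ∀ᶠ n : ℕ in atTop, LargeEnough α n := by
  have h1 : Tendsto (fun n : ℕ => α * (n : ℝ)) atTop atTop :=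
    tendsto_natCast_atTop_atTop.const_mul_atTop hα
  have h2 : Tendsto (fun n : ℕ => (n : ℝ) ^ (α / 2)) atTop atTop :=
    (tendsto_rpow_atTop (by positivity)).comp tendsto_natCast_atTop_atTop
  have h3 : Tendsto (fun n : ℕ => 81 * Real.exp ((n : ℝ) * (2 / 3 : ℝ) ^ ⌊(n : ℝ) ^ α⌋₊)) atTop
      (𝓝 81) := by
    have := ((Real.continuous_exp.tendsto 0).comp (tendsto_mul_pow_floor_rpow hα)).const_mul 81
    simpa using this
  filter_upwards [h1.eventually_ge_atTop 60000, h2.eventually_ge_atTop 6,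
    eventually_rpow_le hα hα1, h3.eventually_lt_const (show (81 : ℝ) < 82 by norm_num)]
    with n a1 a2 a3 a4
  refine ⟨a1, a2, a3, lt_of_le_of_lt ?_ a4⟩
  rw [Real.exp_nat_mul]
  refine mul_le_mul_of_nonneg_left (pow_le_pow_left₀ (by positivity) ?_ n) (by norm_num)
  rw [add_comm]
  exact Real.add_one_le_exp _

theorem LargeEnough.pos {α : ℝ} {n : ℕ} (hα : 0 < α) (hn : LargeEnough α n) : (0 : ℝ) < n := by
  have := hn.linear
  by_contra! h
  nlinarith

theorem LargeEnough.one_le_boundary {α : ℝ} {n : ℕ} (hα : 0 < α) (hn : LargeEnough α n) :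
    1 ≤ 4 * α * n / (n : ℝ) ^ α := by
  have := hn.pos hα
  rw [one_le_div (by positivity)]
  exact hn.rpow_le

theorem LargeEnough.frame_le {α : ℝ} {n : ℕ} (hα : 0 < α) (hn : LargeEnough α n) :
    (⌈α * n / 3000⌉₊ : ℝ) ≤ α * n / 3 := by
  have := hn.pos hα
  have h1 := Nat.ceil_lt_add_one (show 0 ≤ α * n / 3000 by positivity)
  have := hn.linear
  linarith

/-- A subset of size about `g` of a set that is not small. -/
theorem exists_subset_between {g : ℝ} (hg : 1 ≤ g) {V : Type*} {H : Finset V} (hH : g / 2 ≤ H.card) :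
    ∃ B ⊆ H, g / 2 ≤ B.card ∧ (B.card : ℝ) ≤ g := by
  by_cases h : (H.card : ℝ) ≤ g
  · exact ⟨H, le_rfl, hH, h⟩
  · push Not at h
    obtain ⟨B, hB, hBc⟩ := Finset.exists_subset_card_eq (s := H) (n := ⌊g⌋₊)
      (Nat.floor_le_of_le h.le)
    refine ⟨B, hB, ?_, ?_⟩
    · rw [hBc]
      have h1 : (1 : ℝ) ≤ ⌊g⌋₊ := by exact_mod_cast (Nat.one_le_floor_iff g).2 hg
      have h2 := Nat.lt_floor_add_one g
      linarith
    · rw [hBc]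
      exact Nat.floor_le (by linarith)

end Numerics

/-! ### Connectivity, growth of end sets, and covering one matching. -/

section Expanders

variable {V : Type*} [Fintype V] {G : SimpleGraph V} {α : ℝ}

theorem exists_adj_of_mem_extNeighbors {A : Finset V} {v : V} (hv : v ∈ extNeighbors G A) :
    v ∉ A ∧ ∃ a ∈ A, G.Adj a v := by
  simpa [extNeighbors] using hv

/-- The two expansion properties with simplified parameters. -/
theorem IsExpander.simplify (hα : 0 < α) (hn : LargeEnough α (Fintype.card V))
    (hG : IsExpander G ((Fintype.card V : ℝ) ^ α)) :
    (∀ A : Finset V, (A.card : ℝ) ≤ 4 * α * Fintype.card V / (Fintype.card V : ℝ) ^ α →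
      (A.card : ℝ) * (Fintype.card V : ℝ) ^ α ≤ (extNeighbors G A).card) ∧
    (∀ A B : Finset V, Disjoint A B → ⌈α * Fintype.card V / 3000⌉₊ ≤ A.card →
      ⌈α * Fintype.card V / 3000⌉₊ ≤ B.card → ∃ a ∈ A, ∃ b ∈ B, G.Adj a b) := by
  set n := Fintype.card V
  have hn0 : (0 : ℝ) < n := hn.pos hα
  have hn1 : (1 : ℝ) < n := by
    have h1 := hn.six_le
    by_contra! h
    have := Real.rpow_le_one hn0.le h (show 0 ≤ α / 2 by positivity)
    linarith
  have hlog : Real.log n ≠ 0 := (Real.log_pos hn1).ne'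
  have hs : (0 : ℝ) < (n : ℝ) ^ α := by positivity
  have e1 : 4 * (n : ℝ) * Real.log ((n : ℝ) ^ α) / ((n : ℝ) ^ α * Real.log n) =
      4 * α * n / (n : ℝ) ^ α := by
    rw [Real.log_rpow hn0]
    field_simp
  have e2 : (n : ℝ) * Real.log ((n : ℝ) ^ α) / (3000 * Real.log n) = α * n / 3000 := by
    rw [Real.log_rpow hn0]
    field_simp
  obtain ⟨h1, h2⟩ := hG
  rw [e1] at h1
  rw [e2] at h2
  exact ⟨h1, fun A B hAB hA hB => h2 A B hAB (Nat.ceil_le.1 hA) (Nat.ceil_le.1 hB)⟩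

variable [DecidableEq V]

theorem IsExpander.exists_adj_compl (hα : 0 < α) (hn : LargeEnough α (Fintype.card V))
    (hG : IsExpander G ((Fintype.card V : ℝ) ^ α)) (A : Set V) (hA : A.Nonempty)
    (hA' : A ≠ Set.univ) : ∃ u ∈ A, ∃ z ∉ A, G.Adj u z := by
  classical
  obtain ⟨hS, hL⟩ := hG.simplify hα hn
  have hg := hn.one_le_boundary hα
  have hl := hn.frame_le hα
  have hpos := hn.pos hα
  set n := Fintype.card V
  set g := 4 * α * n / (n : ℝ) ^ α with hgdef
  have hsmall : ∀ B : Finset V, B.Nonempty → B.card < ⌈α * n / 3000⌉₊ →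
      ∃ u ∈ B, ∃ z ∉ B, G.Adj u z := by
    intro B hB hBl
    by_cases hBg : (B.card : ℝ) ≤ g
    · have h1 := hS B hBg
      have h2 : (0 : ℝ) < B.card := by exact_mod_cast hB.card_pos
      have h3 : (0 : ℝ) < B.card * (n : ℝ) ^ α := by positivity
      have h4 : 0 < (extNeighbors G B).card := by exact_mod_cast h3.trans_le h1
      obtain ⟨z, hz⟩ := Finset.card_pos.1 h4
      obtain ⟨h5, u, hu, hadj⟩ := exists_adj_of_mem_extNeighbors hz
      exact ⟨u, hu, z, h5, hadj⟩
    -- A set above the boundary `g` need not expand itself, but a subset of size between `g / 2` and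
    -- `g` has at least `2 * α * n` neighbors, more than `B` can contain.
    · obtain ⟨B', hB', h1, h2⟩ := exists_subset_between hg (H := B) (by linarith)
      have h3 := hS B' h2
      have h4 : 2 * α * n ≤ (extNeighbors G B').card := by
        refine le_trans ?_ h3
        have h5 : g * (n : ℝ) ^ α = 4 * α * n := by rw [hgdef]; field_simp
        have h6 : (0 : ℝ) < (n : ℝ) ^ α := by positivity
        nlinarith
      have h5 : B.card < (extNeighbors G B').card := by
        have h6 : (B.card : ℝ) < ⌈α * n / 3000⌉₊ := by exact_mod_cast hBl
        have h7 : 0 < α * n := by positivity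
        have : (B.card : ℝ) < (extNeighbors G B').card := by linarith
        exact_mod_cast this
      obtain ⟨z, hz, hzB⟩ := Finset.exists_mem_notMem_of_card_lt_card h5
      obtain ⟨-, u, hu, hadj⟩ := exists_adj_of_mem_extNeighbors hz
      exact ⟨u, hB' hu, z, hzB, hadj⟩
  obtain ⟨u, hu⟩ := hA
  obtain ⟨z, hz⟩ := (Set.ne_univ_iff_exists_notMem A).1 hA'
  by_cases h1 : A.toFinset.card < ⌈α * n / 3000⌉₊
  · simpa using hsmall A.toFinset ⟨u, by simpa using hu⟩ h1
  by_cases h2 : (Aᶜ).toFinset.card < ⌈α * n / 3000⌉₊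
  · obtain ⟨a, ha, b, hb, hab⟩ := hsmall (Aᶜ).toFinset ⟨z, by simpa using hz⟩ h2
    exact ⟨b, by simpa using hb, a, by simpa using ha, hab.symm⟩
  · obtain ⟨a, ha, b, hb, hab⟩ := hL A.toFinset (Aᶜ).toFinset
      (by rw [Set.disjoint_toFinset]; exact disjoint_compl_right) (not_lt.1 h1) (not_lt.1 h2)
    exact ⟨a, by simpa using ha, b, by simpa using hb, hab⟩

/-- In an expander, sets growing with the neighborhoods become linearly large after a bounded
number of steps. -/
theorem IsExpander.growth (hα : 0 < α) (hα1 : α ≤ 1) (hn : LargeEnough α (Fintype.card V))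
    (hG : IsExpander G ((Fintype.card V : ℝ) ^ α)) {m : Finset (Sym2 V)}
    (hm : (m.card : ℝ) ≤ α * Fintype.card V / 130)
    (hexp : ∀ A : Finset V, (A.card : ℝ) ≤ 4 * α * Fintype.card V / (Fintype.card V : ℝ) ^ α →
      ∃ N : Finset V, N ⊆ extNeighbors G A ∧ (extNeighbors G A).card ≤ 2 * N.card ∧
        ∀ v ∈ N, v ∈ unmatched m)
    (H : ℕ → Finset V) (hmono : Monotone H) (h0 : (H 0).Nonempty)
    (hH : ∀ t, ∀ A : Finset V, (∀ v ∈ A, v ∈ unmatched m ∧ ∃ y ∈ H t, G.Adj y v) →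
      A.card ≤ 3 * (H (t + 1)).card) :
    ⌈(Fintype.card V : ℝ) / 4⌉₊ ≤ (H (⌈2 / α⌉₊ + 2)).card := by
  classical
  obtain ⟨hS, hL⟩ := hG.simplify hα hn
  have hg := hn.one_le_boundary hα
  have hl := hn.frame_le hα
  have hpos := hn.pos hα
  have hl' := Nat.ceil_lt_add_one (show 0 ≤ α * Fintype.card V / 3000 by positivity)
  have hlin := hn.linear
  have hc := hn.six_le
  set n := Fintype.card V with hndef
  set g := 4 * α * n / (n : ℝ) ^ α with hgdef
  set c := (n : ℝ) ^ (α / 2) with hcdef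
  have hsc : (n : ℝ) ^ α = c * c := by
    rw [hcdef, ← Real.rpow_add hpos]
    congr 1
    ring
  have hsg : g * (n : ℝ) ^ α = 4 * α * n := by rw [hgdef]; field_simp
  -- Half of the neighborhood is unmatched, and `hH` loses a further factor 3: in total 6, which is
  -- at most `c`. Thus each step still multiplies by `n ^ α / 6 ≥ c`.
  have step : ∀ t, ∀ B ⊆ H t, (B.card : ℝ) ≤ g →
      (B.card : ℝ) * (n : ℝ) ^ α ≤ 6 * (H (t + 1)).card := by
    intro t B hB hBg
    obtain ⟨N, h1, h2, h3⟩ := hexp B hBg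
    have h4 := hH t N fun v hv => by
      obtain ⟨-, y, hy, hadj⟩ := exists_adj_of_mem_extNeighbors (h1 hv)
      exact ⟨h3 v hv, y, hB hy, hadj⟩
    refine (hS B hBg).trans ?_
    have : (extNeighbors G B).card ≤ 6 * (H (t + 1)).card := by omega
    exact_mod_cast this
  have hmonoR : ∀ t, ((H t).card : ℝ) ≤ (H (t + 1)).card := fun t => by
    exact_mod_cast Finset.card_le_card (hmono (Nat.le_succ t))
  have grow : ∀ t, c ^ t ≤ (H t).card ∨ g / 2 ≤ (H t).card := by
    intro t
    induction t with
    | zero =>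
      left
      rw [pow_zero]
      exact_mod_cast h0.card_pos
    | succ t ih =>
      rcases ih with ih | ih
      · by_cases hHg : ((H t).card : ℝ) ≤ g
        · left
          have h1 := step t (H t) le_rfl hHg
          rw [hsc] at h1
          rw [pow_succ]
          have h2 : (0 : ℝ) ≤ (H t).card := Nat.cast_nonneg _
          nlinarith [mul_nonneg h2 (show 0 ≤ c by linarith)]
        · right
          push Not at hHg
          linarith [hmonoR t]
      · right
        linarith [hmonoR t]
  set t₁ := ⌈2 / α⌉₊
  have h1 : g / 2 ≤ (H t₁).card := by
    rcases grow t₁ with h | h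
    · refine le_trans ?_ h
      have h2 : (n : ℝ) ≤ c ^ t₁ := by
        rw [hcdef, ← Real.rpow_natCast, ← Real.rpow_mul hpos.le]
        have h3 : 1 ≤ α / 2 * t₁ := by
          have := Nat.le_ceil (2 / α)
          calc 1 = α / 2 * (2 / α) := by field_simp
            _ ≤ _ := by gcongr
        have h4 : (1 : ℝ) ≤ n := by nlinarith
        calc (n : ℝ) = (n : ℝ) ^ (1 : ℝ) := (Real.rpow_one _).symm
          _ ≤ _ := Real.rpow_le_rpow_of_exponent_le h4 h3
      have h3 : g ≤ n := by
        have h5 : (36 : ℝ) ≤ (n : ℝ) ^ α := by rw [hsc]; nlinarith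
        rw [hgdef, div_le_iff₀ (by linarith)]
        nlinarith
      linarith
    · exact h
  obtain ⟨B, hB, hB1, hB2⟩ := exists_subset_between hg h1
  have h2 := step t₁ B hB hB2
  have h3 : ⌈α * n / 3000⌉₊ ≤ (H (t₁ + 1)).card := by
    have h4 : (0 : ℝ) < (n : ℝ) ^ α := by positivity
    have : (⌈α * n / 3000⌉₊ : ℝ) ≤ (H (t₁ + 1)).card := by nlinarith
    exact_mod_cast this
  -- For the last step property `L` takes over: a subset of exactly frame size has neighbors in all
  -- but fewer than that many of the unmatched vertices outside it.
  obtain ⟨A, hA, hAc⟩ := Finset.exists_subset_card_eq h3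
  let N := Finset.univ.filter fun v => v ∈ unmatched m ∧ ∃ y ∈ A, G.Adj y v
  have hN : N.card ≤ 3 * (H (t₁ + 2)).card := hH (t₁ + 1) N fun v hv => by
    obtain ⟨-, h4, y, hy, hadj⟩ := Finset.mem_filter.1 hv
    exact ⟨h4, y, hA hy, hadj⟩
  let W := Finset.univ.filter fun v => v ∉ unmatched m
  have hW : W.card ≤ 2 * m.card := card_matched_le m W (by simp [W])
  let Z := Finset.univ \ (W ∪ N ∪ A)
  have hZ : Z.card < ⌈α * n / 3000⌉₊ := by
    by_contra! hZ
    obtain ⟨a, ha, z, hz, hadj⟩ := hL A Z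
      (Finset.disjoint_of_subset_left Finset.subset_union_right Finset.disjoint_sdiff) hAc.ge hZ
    simp only [Z, W, N, Finset.mem_sdiff, Finset.mem_union, Finset.mem_filter, Finset.mem_univ,
      true_and, not_or, not_not] at hz
    exact hz.1.2 ⟨hz.1.1, a, ha, hadj⟩
  have h5 : n ≤ Z.card + (W.card + N.card + A.card) := by
    have h6 := Finset.le_card_sdiff (W ∪ N ∪ A) Finset.univ
    rw [Finset.card_univ, ← hndef] at h6
    have h7 := Finset.card_union_le (W ∪ N) A
    have h8 := Finset.card_union_le W N
    have h9 : Z.card = (Finset.univ \ (W ∪ N ∪ A)).card := rfl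
    omega
  have h6 : n ≤ 2 * ⌈α * n / 3000⌉₊ + 2 * m.card + 3 * (H (t₁ + 2)).card := by omega
  rw [Nat.ceil_le]
  have h7 : (n : ℝ) ≤ 2 * ⌈α * n / 3000⌉₊ + 2 * m.card + 3 * (H (t₁ + 2)).card := by
    exact_mod_cast h6
  have h8 : α * n ≤ n := by nlinarith
  linarith

/-- Every matching of an expander is covered by a bounded number of Hamilton cycles. -/
theorem IsExpander.exists_cover_matching (hα : 0 < α) (hα1 : α ≤ 1)
    (hn : LargeEnough α (Fintype.card V)) (hG : IsExpander G ((Fintype.card V : ℝ) ^ α))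
    {m : Finset (Sym2 V)} (hm : PairwiseDisjointEdges m) (hmG : ∀ e ∈ m, e ∈ G.edgeSet) :
    ∃ F : Finset G.Subgraph, (∀ C ∈ F, IsHamiltonCycle G C) ∧
      (∀ e ∈ m, ∃ C ∈ F, e ∈ C.edgeSet) ∧ F.card ≤ 81 * ⌈131 / α⌉₊ := by
  classical
  have hpos := hn.pos hα
  have hlin := hn.linear
  obtain ⟨hS, hL⟩ := hG.simplify hα hn
  have hV : Nonempty V := Fintype.card_pos_iff.1 (by exact_mod_cast hpos)
  have hm_card := hm.card_le
  have hcol := hn.colours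
  have hconn := hG.exists_adj_compl hα hn
  have hgrow := fun m' => hG.growth hα hα1 hn (m := m')
  set n := Fintype.card V with hndef
  set k := ⌈131 / α⌉₊
  set b := ⌊α * n / 130⌋₊
  have hk : 131 / α ≤ k := Nat.le_ceil _
  have hk0 : 0 < k := by
    have : (0 : ℝ) < k := lt_of_lt_of_le (by positivity) hk
    exact_mod_cast this
  have hb : (b : ℝ) ≤ α * n / 130 := Nat.floor_le (by positivity)
  have hkb : m.card ≤ k * b := by
    refine hm_card.trans ?_
    have h1 := Nat.lt_floor_add_one (α * n / 130)
    have h2 : (n : ℝ) ≤ k * b := by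
      calc (n : ℝ) ≤ 131 / α * (α * n / 130 - 1) := by
            rw [div_mul_eq_mul_div, le_div_iff₀ hα]
            linarith
        _ ≤ k * b := mul_le_mul hk (by linarith) (by linarith) (by positivity)
    exact_mod_cast h2
  obtain ⟨c, hc⟩ := exists_bounded_pieces m k b hk0 hkb
  obtain ⟨f, hf⟩ := exists_splitting_colouring G hm
    (fun A => (A.card : ℝ) ≤ 4 * α * n / (n : ℝ) ^ α) ⌊(n : ℝ) ^ α⌋₊ (by
      intro A hA
      have h1 := hS A hA
      have h2 := Nat.floor_le (show 0 ≤ (n : ℝ) ^ α by positivity)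
      have h3 : ((⌊(n : ℝ) ^ α⌋₊ * A.card : ℕ) : ℝ) ≤ (extNeighbors G A).card := by
        push_cast
        refine le_trans ?_ h1
        rw [mul_comm]
        gcongr
      exact_mod_cast h3) hcol
  have hcyc : ∀ ij : Fin 81 × Fin k, ∃ C : G.Subgraph, IsHamiltonCycle G C ∧
      ∀ e ∈ m.filter (fun e => f e = ij.1 ∧ c e = ij.2), e ∈ C.edgeSet := by
    rintro ⟨i, j⟩
    set m' := m.filter (fun e => f e = i ∧ c e = j)
    have hm' : m' ⊆ m := Finset.filter_subset _ _
    have hm'c : m'.card ≤ b := by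
      refine le_trans (Finset.card_le_card fun e he => ?_) (hc j)
      obtain ⟨h1, -, h2⟩ := Finset.mem_filter.1 he
      exact Finset.mem_filter.2 ⟨h1, h2⟩
    have hm'R : (m'.card : ℝ) ≤ α * n / 130 := le_trans (by exact_mod_cast hm'c) hb
    have hl0 : 0 < ⌈α * n / 3000⌉₊ := Nat.ceil_pos.2 (by positivity)
    refine exists_isHamiltonCycle_containing (l := ⌈α * n / 3000⌉₊) (N := ⌈(n : ℝ) / 4⌉₊)
      (T := ⌈2 / α⌉₊ + 2) (fun e he f hf => hm e (hm' he) f (hm' hf))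
      (fun e he => hmG e (hm' he)) hconn hl0 hL (hgrow m' hm'R ?_) ?_
    · intro A hA
      obtain ⟨N, h1, h2, h3⟩ := hf A hA i
      refine ⟨N, h1, h2, fun v hv e he => h3 v hv e ?_⟩
      obtain ⟨h4, h5, -⟩ := Finset.mem_filter.1 he
      exact Finset.mem_filter.2 ⟨h4, h5⟩
    -- The number of segments times their length is at most `(13 / α) * (α * n / 55)`, and `13 / 55
    -- < 1 / 4`.
    · have h1 : ((2 * (⌈2 / α⌉₊ + 2) + 3 : ℕ) : ℝ) ≤ 13 / α := by
        have h2 := Nat.ceil_lt_add_one (show 0 ≤ 2 / α by positivity)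
        have h3 : 1 ≤ 1 / α := by rw [one_le_div hα]; exact hα1
        have h4 : 13 / α = 2 * (2 / α) + 9 * (1 / α) := by field_simp; norm_num
        push_cast
        linarith
      have h2 : ((7 * ⌈α * n / 3000⌉₊ + 2 * m'.card + 3 : ℕ) : ℝ) ≤ α * n / 55 := by
        have h3 := Nat.ceil_lt_add_one (show 0 ≤ α * n / 3000 by positivity)
        push_cast
        linarith
      have h3 : (((2 * (⌈2 / α⌉₊ + 2) + 3) * (7 * ⌈α * n / 3000⌉₊ + 2 * m'.card + 3) : ℕ) : ℝ) ≤
          ⌈(n : ℝ) / 4⌉₊ := by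
        refine le_trans ?_ (Nat.le_ceil _)
        rw [Nat.cast_mul]
        calc _ ≤ 13 / α * (α * n / 55) :=
              mul_le_mul h1 h2 (Nat.cast_nonneg _) (by positivity)
          _ = 13 / 55 * n := by field_simp
          _ ≤ n / 4 := by linarith
      exact_mod_cast h3
  choose C hC1 hC2 using hcyc
  have hfin : (Set.range C).Finite := Set.finite_range C
  refine ⟨hfin.toFinset, ?_, ?_, ?_⟩
  · intro D hD
    obtain ⟨ij, rfl⟩ := hfin.mem_toFinset.1 hD
    exact hC1 ij
  · intro e he
    exact ⟨C (f e, c e), hfin.mem_toFinset.2 ⟨_, rfl⟩,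
      hC2 _ e (Finset.mem_filter.2 ⟨he, rfl, rfl⟩)⟩
  · rw [← Set.ncard_eq_toFinset_card _ hfin, ← Set.image_univ]
    refine (Set.ncard_image_le Set.finite_univ).trans ?_
    simp [Set.ncard_univ]

end Expanders

end HamiltonCovering

theorem theorem2 (α : ℝ) (hα : 0 < α) (hα1 : α ≤ 1) :
    ∃ n₀ : ℕ, ∀ n : ℕ, n₀ ≤ n →
      ∀ (V : Type*) [Fintype V] [DecidableEq V] (G : SimpleGraph V) [DecidableRel G.Adj],
        Fintype.card V = n →
        HamiltonCovering.IsExpander G ((n : ℝ) ^ α) →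
        ∀ (h : ℕ) (P : Finset G.Subgraph),
          HamiltonCovering.IsHamiltonPacking G P → P.card = h →
          ∃ F : Finset G.Subgraph, HamiltonCovering.IsHamiltonCovering G F ∧
            (F.card : ℝ) ≤ (h : ℝ) + 28000 * ((G.maxDegree : ℝ) - 2 * (h : ℝ)) / α ^ 4 := by
  obtain ⟨n₀, hn₀⟩ := Filter.eventually_atTop.1
    (HamiltonCovering.eventually_largeEnough hα hα1)
  refine ⟨n₀, ?_⟩
  rintro n hn V _ _ G _ rfl hG h P hP rfl
  have hn := hn₀ _ hn
  classical
  let E := G.edgeFinset.filter fun e => ∀ C ∈ P, e ∉ C.edgeSet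
  have hV : Nonempty V := Fintype.card_pos_iff.1 (by exact_mod_cast hn.pos hα)
  have hdeg : 2 * P.card ≤ G.maxDegree := by
    have := hP.card_uncovered_le hV.some
    omega
  obtain ⟨c, hc1, hc2⟩ := HamiltonCovering.exists_edgeColouring E (G.maxDegree - 2 * P.card)
    fun v => by
      have := hP.card_uncovered_le v
      have h2 : (E.filter fun e => v ∈ e).card + 2 * P.card ≤ G.maxDegree := this
      omega
  have hcover : ∀ i : ℕ, ∃ F : Finset G.Subgraph,
      (∀ C ∈ F, HamiltonCovering.IsHamiltonCycle G C) ∧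
      (∀ e ∈ E.filter (fun e => c e = i), ∃ C ∈ F, e ∈ C.edgeSet) ∧
      F.card ≤ 81 * ⌈131 / α⌉₊ := by
    intro i
    refine hG.exists_cover_matching hα hα1 hn ?_ ?_
    · intro e he f hf v hve hvf
      obtain ⟨he, hei⟩ := Finset.mem_filter.1 he
      obtain ⟨hf, hfi⟩ := Finset.mem_filter.1 hf
      exact hc2 e he f hf (hei.trans hfi.symm) v hve hvf
    · intro e he
      exact SimpleGraph.mem_edgeFinset.1 (Finset.mem_filter.1 (Finset.mem_filter.1 he).1).1
  choose F hF1 hF2 hF3 using hcover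
  refine ⟨P ∪ (Finset.range (2 * (G.maxDegree - 2 * P.card))).biUnion F, ⟨?_, ?_⟩, ?_⟩
  · intro C hC
    rcases Finset.mem_union.1 hC with hC | hC
    · exact hP.1 C hC
    · obtain ⟨i, -, hC⟩ := Finset.mem_biUnion.1 hC
      exact hF1 i C hC
  · intro e he
    by_cases heP : ∃ C ∈ P, e ∈ C.edgeSet
    · obtain ⟨C, hC, heC⟩ := heP
      exact ⟨C, Finset.mem_union_left _ hC, heC⟩
    · push Not at heP
      have heE : e ∈ E := Finset.mem_filter.2 ⟨SimpleGraph.mem_edgeFinset.2 he, heP⟩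
      obtain ⟨C, hC, heC⟩ := hF2 (c e) e (Finset.mem_filter.2 ⟨heE, rfl⟩)
      exact ⟨C, Finset.mem_union_right _
        (Finset.mem_biUnion.2 ⟨c e, Finset.mem_range.2 (hc1 e heE), hC⟩), heC⟩
  · have h1 : (P ∪ (Finset.range (2 * (G.maxDegree - 2 * P.card))).biUnion F).card ≤
        P.card + 2 * (G.maxDegree - 2 * P.card) * (81 * ⌈131 / α⌉₊) := by
      refine (Finset.card_union_le _ _).trans (Nat.add_le_add_left ?_ _)
      refine (Finset.card_biUnion_le_card_mul _ _ _ fun i _ => hF3 i).trans ?_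
      rw [Finset.card_range]
    -- Here `81 * 132 ≤ 14000`, and `α ^ 4 ≤ α` weakens the linear dependence on `1 / α`; doubling
    -- for the number of matchings gives 28000.
    have h2 : (81 * ⌈131 / α⌉₊ : ℝ) ≤ 14000 / α ^ 4 := by
      have h3 := Nat.ceil_lt_add_one (show 0 ≤ 131 / α by positivity)
      have h4 : α ^ 4 ≤ α := pow_le_of_le_one hα.le hα1 (by norm_num)
      calc (81 * ⌈131 / α⌉₊ : ℝ) ≤ 81 * (132 / α) := by
            have h5 : 1 ≤ 1 / α := by rw [one_le_div hα]; exact hα1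
            have h6 : 132 / α = 131 / α + 1 / α := by ring
            linarith
        _ ≤ 14000 / α := by rw [← mul_div_assoc]; gcongr; norm_num
        _ ≤ 14000 / α ^ 4 := by gcongr
    have h3 : ((P ∪ (Finset.range (2 * (G.maxDegree - 2 * P.card))).biUnion F).card : ℝ) ≤
        P.card + 2 * ((G.maxDegree : ℝ) - 2 * P.card) * (81 * ⌈131 / α⌉₊) := by
      have h4 : (((G.maxDegree - 2 * P.card : ℕ)) : ℝ) = (G.maxDegree : ℝ) - 2 * P.card := by
        rw [Nat.cast_sub hdeg]
        push_cast
        ring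
      rw [← h4]
      exact_mod_cast h1
    have h4 : (0 : ℝ) ≤ (G.maxDegree : ℝ) - 2 * P.card := by
      rw [sub_nonneg]
      exact_mod_cast hdeg
    calc _ ≤ _ := h3
      _ ≤ P.card + 2 * ((G.maxDegree : ℝ) - 2 * P.card) * (14000 / α ^ 4) := by gcongr
      _ = _ := by ring
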